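/- **Definitions.** For a domain $A$ with fraction field $\mathcal K(A)$, let $\sum\mathcal K(A)^2$ be the set of finite sums of squares in $\mathcal K(A)$. An ideal $I$ of $A$ is *central* if for all $a\in A$ and $b\in\sum \mathcal K(A)^2$, $a^2+b\in I$ implies $a\in I$. The *central radical* ${\rm Rad}^C(A)$ is the intersection of the maximal and central ideals of $A$ (equal to $A$ if there are none). Let $X$ be an integral scheme of finite type over $\mathbb R$, and let $X_{reg}(\mathbb R)$ be the set of closed points of $X$ with real residue field at which $X$ is smooth over $\mathbb R$. Let $\pi:Y\to X$ be a dominant morphism of finite type with $Y$ an integral scheme; it induces a field extension $\mathcal K(X)\to\mathcal K(Y)$. - The integral closure $(\mathcal O_X)'_{\pi_*\mathcal O_Y}$ of $\mathcal O_X$ in $\pi_*\mathcal O_Y$ is the $\mathcal O_X$-subalgebra of $\pi_*\mathcal O_Y$ whose sections over an open set $U$ are the $f\in H^0(U,\pi_*\mathcal O_Y)$ such that $f_x\in(\pi_*\mathcal O_Y)_x$ is integral over $\mathcal O_{X,x}$ for every $x\in U$. - The integral and birational closure $\mathcal B$ of $\mathcal O_X$ in $\pi_*\mathcal O_Y$ is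 the subalgebra of $(\mathcal O_X)'_{\pi_*\mathcal O_Y}$ of the sections whose image in $\mathcal K(Y)$ lies in $\mathcal K(X)$. - The *central seminormalization* $(\mathcal O_X)^{s_c,*}_Y$ of $\mathcal O_X$ in $\pi_*\mathcal O_Y$ is the following $\mathcal O_X$-subalgebra of $\pi_*\mathcal O_Y$. If $X_{reg}(\mathbb R)\neq\emptyset$, its sections over an open set $U$ are the $f\in H^0(U,\mathcal B)$ such that $f_x\in \mathcal O_{X,x}+{\rm Rad}^C(\mathcal B_x)$ for every $x\in U$. If $X_{reg}(\mathbb R)=\emptyset$, it is $(\mathcal O_X)'_{\pi_*\mathcal O_Y}$. **Theorem.** Let $X$ be an integral scheme of finite type over $\mathbb R$ and let $\pi:Y\to X$ be a dominant morphism of finite type with $Y$ an integral scheme. 1. The $\mathcal O_X$-algebra $(\mathcal O_X)^{s_c,*}_Y$ is a coherent sheaf on $X$. 2. There exist an integral scheme $X^{s_c,*}_Y$, a finite morphism $\pi^{s_c,*}_Y:X^{s_c,*}_Y\to X$ and a morphism $q:Y\to X^{s_c,*}_Y$ with $\pi=\pi^{s_c,*}_Y\circ q$, together with an isomorphism of $\mathcal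 O_X$-algebras $(\mathcal O_X)^{s_c,*}_Y\cong(\pi^{s_c,*}_Y)_*\mathcal O_{X^{s_c,*}_Y}$ whose composite with the morphism $(\pi^{s_c,*}_Y)_*\mathcal O_{X^{s_c,*}_Y}\to\pi_*\mathcal O_Y$ induced by $q$ is the inclusion; that is, $X^{s_c,*}_Y={\rm Spec}\,(\mathcal O_X)^{s_c,*}_Y$. -/

import Mathlib

open CategoryTheory AlgebraicGeometry Opposite TopologicalSpace

noncomputable section

namespace CentralSeminormalization

/-! ### Central ideals -/

section Ring

variable {A : Type*} [CommRing A]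

/-- An ideal `I` of a domain `A` is central if for all `a` in `A` and every sum of squares `b` in
the fraction field `K(A)`, `a ^ 2 + b ∈ I` implies `a ∈ I`. (The element `a ^ 2 + b` of `K(A)` is
in `I` when it is the image of an element `c` of `I`.) -/
def IsCentralIdeal (I : Ideal A) : Prop :=
  ∀ (a : A) (b : FractionRing A), IsSumSq b →
    (∃ c ∈ I, algebraMap A (FractionRing A) c = algebraMap A (FractionRing A) a ^ 2 + b) → a ∈ I

variable (A) in
/-- The central Jacobson radical: the intersection of the maximal and central ideals of `A`
(the whole of `A` if there are none). -/
def centralRadical : Ideal A :=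
  sInf {I : Ideal A | I.IsMaximal ∧ IsCentralIdeal I}

/-- The subring `f(A) + J` of `B`, for a ring morphism `f : A → B` and an ideal `J` of `B`. -/
def rangeAddIdeal {B : Type*} [CommRing B] (f : A →+* B) (J : Ideal B) : Subring B where
  carrier := {b | ∃ a : A, ∃ r ∈ J, f a + r = b}
  one_mem' := ⟨1, 0, J.zero_mem, by simp⟩
  zero_mem' := ⟨0, 0, J.zero_mem, by simp⟩
  mul_mem' := by
    rintro _ _ ⟨a, r, hr, rfl⟩ ⟨a', r', hr', rfl⟩
    refine ⟨a * a', f a * r' + r * (f a' + r'), ?_, by rw [map_mul]; ring⟩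
    exact J.add_mem (J.mul_mem_left _ hr') (J.mul_mem_right _ hr)
  add_mem' := by
    rintro _ _ ⟨a, r, hr, rfl⟩ ⟨a', r', hr', rfl⟩
    exact ⟨a + a', r + r', J.add_mem hr hr', by rw [map_add]; ring⟩
  neg_mem' := by
    rintro _ ⟨a, r, hr, rfl⟩
    exact ⟨-a, -r, J.neg_mem hr, by rw [map_neg]; ring⟩

/-- The integral closure, in `B`, of the image of `f : A → B`. -/
def integralElements {B : Type*} [CommRing B] (f : A →+* B) : Subring B where
  carrier := {b | f.IsIntegralElem b}
  one_mem' := f.isIntegralElem_one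
  zero_mem' := f.isIntegralElem_zero
  mul_mem' h h' := RingHom.IsIntegralElem.mul f h h'
  add_mem' h h' := RingHom.IsIntegralElem.add f h h'
  neg_mem' h := RingHom.IsIntegralElem.neg f h

end Ring

/-! ### Algebras over the structure sheaf

A presheaf of `𝒪_X`-algebras is given by a presheaf of rings `F` on `X` and a morphism of
presheaves of rings `φ : 𝒪_X ⟶ F`. -/

variable {X : Scheme.{0}} {F : TopCat.Presheaf CommRingCat.{0} X} (φ : X.presheaf ⟶ F)

/-- A presheaf of `𝒪_X`-subalgebras of the presheaf of `𝒪_X`-algebras `φ : 𝒪_X ⟶ F`. -/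
structure SubalgebraPresheaf where
  /-- the sections over an open subset -/
  obj (U : (Opens X)ᵒᵖ) : Subring (F.obj U)
  app_mem (U : (Opens X)ᵒᵖ) (a : X.presheaf.obj U) : (φ.app U).hom a ∈ obj U
  map_mem {U V : (Opens X)ᵒᵖ} (i : U ⟶ V) {f : F.obj U} (hf : f ∈ obj U) :
    (F.map i).hom f ∈ obj V

namespace SubalgebraPresheaf

variable {φ} (S : SubalgebraPresheaf φ)

/-- The underlying presheaf of rings. -/
def presheaf : TopCat.Presheaf CommRingCat.{0} X where
  obj U := CommRingCat.of (S.obj U)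
  map {U V} i := CommRingCat.ofHom
    ((F.map i).hom.restrict (S.obj U) (S.obj V) fun _ hf ↦ S.map_mem i hf)
  map_id U := by
    ext f
    exact congr($(F.map_id U) f.1)
  map_comp i j := by
    ext f
    exact congr($(F.map_comp i j) f.1)

/-- The structure morphism `𝒪_X ⟶ S`. -/
def structureMap : X.presheaf ⟶ S.presheaf where
  app U := CommRingCat.ofHom ((φ.app U).hom.codRestrict (S.obj U) (S.app_mem U))
  naturality U V i := by
    ext a
    apply Subtype.ext
    exact congr($(φ.naturality i) a)

/-- A subalgebra of a subalgebra of `F`, seen as a subalgebra of `F`. -/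
def trans (T : SubalgebraPresheaf S.structureMap) : SubalgebraPresheaf φ where
  obj U := (T.obj U).map (S.obj U).subtype
  app_mem U a := ⟨_, T.app_mem U a, rfl⟩
  map_mem := by
    rintro U V i _ ⟨f, hf, rfl⟩
    exact ⟨_, T.map_mem i hf, rfl⟩

end SubalgebraPresheaf

/-- The presheaf of `𝒪_X`-modules underlying a presheaf of `𝒪_X`-algebras. -/
def toPresheafOfModules : X.PresheafOfModules :=
  (PresheafOfModules.restrictScalars (Functor.whiskerRight φ (forget₂ CommRingCat RingCat))).obj
    (PresheafOfModules.unit (F ⋙ forget₂ CommRingCat RingCat))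

/-- The presheaf of `𝒪_X`-subalgebras of `F` whose sections over `U` are those `f` such that the
germ `f_x` lies in a given subring `R x` of the stalk `F_x` for all `x ∈ U`. -/
def subalgebraOfStalks (R : ∀ x : X, Subring (F.stalk x))
    (hR : ∀ x a, (TopCat.Presheaf.stalkFunctor CommRingCat x).map φ a ∈ R x) :
    SubalgebraPresheaf φ where
  obj U :=
    { carrier := {f | ∀ (x : X) (hx : x ∈ U.unop), F.germ U.unop x hx f ∈ R x}
      one_mem' := fun x hx ↦ by rw [map_one]; exact one_mem _
      zero_mem' := fun x hx ↦ by rw [map_zero]; exact zero_mem _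
      mul_mem' := fun h h' x hx ↦ by rw [map_mul]; exact mul_mem (h x hx) (h' x hx)
      add_mem' := fun h h' x hx ↦ by rw [map_add]; exact add_mem (h x hx) (h' x hx)
      neg_mem' := fun h x hx ↦ by rw [map_neg]; exact neg_mem (h x hx) }
  app_mem U a x hx := by
    have := hR x (X.presheaf.germ U.unop x hx a)
    rwa [TopCat.Presheaf.stalkFunctor_map_germ_apply] at this
  map_mem i f hf x hx := by
    have := hf x (i.unop.le hx)
    rwa [← TopCat.Presheaf.germ_res_apply F i.unop x hx] at this

/-- The integral closure of `𝒪_X` in `F`: the sections all of whose germs `f_x` are integral over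
`𝒪_{X,x}`. -/
def integralClosurePresheaf : SubalgebraPresheaf φ :=
  subalgebraOfStalks φ
    (fun x ↦ integralElements ((TopCat.Presheaf.stalkFunctor CommRingCat x).map φ).hom)
    (fun _ _ ↦ RingHom.isIntegralElem_map _)

/-- The central gluing of `F` over `𝒪_X`: the sections `f` of `F` over `U` such that
`f_x ∈ 𝒪_{X,x} + Rad^C(F_x)` for all `x ∈ U`. -/
def centralGluing : SubalgebraPresheaf φ :=
  subalgebraOfStalks φ
    (fun x ↦ rangeAddIdeal ((TopCat.Presheaf.stalkFunctor CommRingCat x).map φ).hom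
      (centralRadical (F.stalk x)))
    (fun _ a ↦ ⟨a, 0, Ideal.zero_mem _, add_zero _⟩)

/-! ### The central seminormalization -/

variable {Y : Scheme.{0}}

/-- The integral and birational closure of `𝒪_X` in `π_* 𝒪_Y`, for a dominant morphism `π : Y ⟶ X`
of integral schemes: the sections of the integral closure whose image in `K(Y)` lies in `K(X)`.
Here `K(Y)` is the stalk of `𝒪_Y` at the generic point `η` of `Y`, the point `π η` is the generic
point of `X` since `π` is dominant, and `K(X) ⟶ K(Y)` is the morphism of stalks induced by `π`. -/
def birationalIntegralClosure [IsIntegral Y] (π : Y ⟶ X) : SubalgebraPresheaf π.c where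
  obj U :=
    { carrier := {f | f ∈ (integralClosurePresheaf π.c).obj U ∧
        ∀ h : genericPoint Y ∈ π ⁻¹ᵁ U.unop,
          (Y.presheaf.germ (π ⁻¹ᵁ U.unop) (genericPoint Y) h).hom f ∈
            (π.stalkMap (genericPoint Y)).hom.range}
      one_mem' := ⟨one_mem _, fun h ↦ by
        erw [map_one]; exact one_mem _⟩
      zero_mem' := ⟨zero_mem _, fun h ↦ by
        erw [map_zero]; exact zero_mem _⟩
      mul_mem' := fun h h' ↦ ⟨mul_mem h.1 h'.1, fun hx ↦ by
        erw [map_mul]; exact mul_mem (h.2 hx) (h'.2 hx)⟩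
      add_mem' := fun h h' ↦ ⟨add_mem h.1 h'.1, fun hx ↦ by
        erw [map_add]; exact add_mem (h.2 hx) (h'.2 hx)⟩
      neg_mem' := fun h ↦ ⟨neg_mem h.1, fun hx ↦ by
        erw [map_neg]; exact neg_mem (h.2 hx)⟩ }
  app_mem U a := ⟨(integralClosurePresheaf π.c).app_mem U a, fun h ↦
    ⟨X.presheaf.germ U.unop (π (genericPoint Y)) h a, Scheme.Hom.germ_stalkMap_apply π U.unop _ h a⟩⟩
  map_mem {U V} i f hf := ⟨(integralClosurePresheaf π.c).map_mem i hf.1, fun h ↦ by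
    have h1 := hf.2 (i.unop.le h)
    have h2 := TopCat.Presheaf.germ_res_apply Y.presheaf ((Opens.map π.base).map i.unop)
      (genericPoint Y) h f
    exact (congrArg (· ∈ (π.stalkMap (genericPoint Y)).hom.range) h2).mpr h1⟩

/-- The set `X_reg(ℝ)` of smooth real closed points of a scheme `X` over `ℝ`. A point is real if its
residue field is a real field, i.e. `-1` is not a sum of squares in it; it is smooth if it has an
open neighbourhood which is smooth over `ℝ`. -/
def smoothRealClosedPoints (s : X ⟶ Spec (CommRingCat.of ℝ)) : Set X :=
  {x | IsClosed {x} ∧ IsSemireal (X.residueField x) ∧ ∃ U : X.Opens, x ∈ U ∧ Smooth (U.ι ≫ s)}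

open Classical in
/-- The central seminormalization of `𝒪_X` in `π_* 𝒪_Y`: the central gluing over `𝒪_X` of the
integral and birational closure of `𝒪_X` in `π_* 𝒪_Y` if `X_reg(ℝ)` is non-empty, and the
integral closure of `𝒪_X` in `π_* 𝒪_Y` otherwise. -/
def centralSeminormalization [IsIntegral Y] (s : X ⟶ Spec (CommRingCat.of ℝ)) (π : Y ⟶ X) :
    SubalgebraPresheaf π.c :=
  if (smoothRealClosedPoints s).Nonempty then
    (birationalIntegralClosure π).trans (centralGluing (birationalIntegralClosure π).structureMap)
  else integralClosurePresheaf π.c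

/-- Coherence of an `𝒪_X`-module on a locally noetherian scheme: it is quasi-coherent and locally
generated by finitely many sections. -/
def IsCoherent (M : X.Modules) : Prop :=
  SheafOfModules.IsQuasicoherent.{0} M ∧ SheafOfModules.IsFiniteType.{0} M

/-- A presheaf of `𝒪_X`-modules is a coherent sheaf. -/
def IsCoherentSheaf (M : X.PresheafOfModules) : Prop :=
  ∃ h : Presheaf.IsSheaf (Opens.grothendieckTopology X) M.presheaf,
    IsCoherent (X := X) (⟨M, h⟩ : SheafOfModules X.ringCatSheaf)

end CentralSeminormalization

end

noncomputable section

namespace CentralSeminormalization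

-- Two properties of a subalgebra `S` of `π_* 𝒪_Y` suffice: it is quasi-coherent (membership is
-- local, and a section over `D(r)` extends to an affine `U` after multiplication by a power of
-- `r`), and `S(U)` is finite over `𝒪_X(U)` for affine `U`. Then `S` is coherent, the `Spec S(U)`
-- glue to a finite `X`-scheme, and this scheme is integral because its functions inject into those
-- of the integral scheme `Y` (`exists_relSpec`).
--
-- Finiteness: in both cases of the definition the algebra lies in the integral closure, so over an
-- affine open it embeds in the integral closure of `A = 𝒪_X(U)` in a domain `D` of finite type over
-- `A`. That is a noetherian module (`isNoetherian_integralClosure`): after Noether normalization,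
-- `D` may be transcendental over the polynomial ring `P`, but it specializes to a finite extension
-- of `Frac P`, separable in characteristic zero, and integral elements are not lost under
-- specialization.
--
-- Quasi-coherence: for the integral closure one clears denominators in integral equations, and the
-- birationality condition concerns only the generic point. For the central gluing
-- (`mul_mem_centralGluing`), suppose that `g` over `U` satisfies the gluing condition on `D(r)`.
-- Then `r * g` satisfies it on all of `U`: at `x` outside `D(r)` the germ of `r` is in the maximal
-- ideal of `𝒪_{X,x}`, hence in every maximal ideal of the integral extension `ℬ_x`, hence in
-- `Rad^C(ℬ_x)`. Only the inclusion of the Jacobson radical in `Rad^C` matters, so no real geometry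
-- enters, and the case distinction on `X_reg(ℝ)` merely selects the algebra.

universe u v

/-! ### Finiteness of integral closures. -/

/-- A nonzero finitely generated algebra over a domain `P`, without `P`-torsion, has a morphism to
a finite extension of `Frac P`. -/
theorem exists_algHom_finite_fractionRing (P : Type u) (D : Type v) [CommRing P]
    [IsDomain P] [CommRing D] [IsDomain D] [Algebra P D] [FaithfulSMul P D]
    [Algebra.FiniteType P D] :
    ∃ (L : Type v) (_ : Field L) (_ : Algebra P L) (_ : Algebra (FractionRing P) L)
      (_ : IsScalarTower P (FractionRing P) L),
      FiniteDimensional (FractionRing P) L ∧ Nonempty (D →ₐ[P] L) := by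
  let E := FractionRing D
  let k := FractionRing P
  let _ : Algebra k E := FractionRing.liftAlgebra P E
  have : IsScalarTower P k E := FractionRing.isScalarTower_liftAlgebra P E
  obtain ⟨s, hs⟩ := (inferInstance : Algebra.FiniteType P D).out
  let B : Subalgebra k E := Algebra.adjoin k (algebraMap D E '' s)
  have hmem (d : D) : algebraMap D E d ∈ B.restrictScalars P := by
    have h : d ∈ Algebra.adjoin P (s : Set D) := hs ▸ Algebra.mem_top
    have h2 : (IsScalarTower.toAlgHom P D E) d ∈
        (Algebra.adjoin P (s : Set D)).map (IsScalarTower.toAlgHom P D E) := ⟨d, h, rfl⟩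
    rw [AlgHom.map_adjoin] at h2
    refine (Algebra.adjoin_le (S := B.restrictScalars P) ?_) h2
    exact Algebra.subset_adjoin (R := k)
  let g : D →ₐ[P] B.restrictScalars P :=
    (IsScalarTower.toAlgHom P D E).codRestrict (B.restrictScalars P) hmem
  have hft : Algebra.FiniteType k B := by
    rw [← Subalgebra.fg_iff_finiteType]
    classical
    exact ⟨s.image (algebraMap D E), by simp [B]⟩
  -- `B` is the `k`-algebra generated by `D` in `Frac D`. By Zariski's lemma its residue fields are
  -- finite over `k`.
  obtain ⟨m, hm⟩ := Ideal.exists_maximal B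
  let _ : Field (B ⧸ m) := Ideal.Quotient.field m
  have : Algebra.FiniteType k (B ⧸ m) := .of_surjective (Ideal.Quotient.mkₐ k m)
    (Ideal.Quotient.mkₐ_surjective k m)
  refine ⟨B ⧸ m, inferInstance, inferInstance, inferInstance, inferInstance,
    finite_of_finite_type_of_isJacobsonRing _ _, ⟨?_⟩⟩
  exact ((Ideal.Quotient.mkₐ P m)).comp g

/-- The integral closure of a domain of finite type over a field of characteristic zero in a domain
of finite type over it is a noetherian module. -/
theorem isNoetherian_integralClosure (k A D : Type*) [Field k] [CharZero k] [CommRing A]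
    [IsDomain A] [Algebra k A] [Algebra.FiniteType k A] [CommRing D] [IsDomain D] [Algebra A D]
    [FaithfulSMul A D] [Algebra.FiniteType A D] : IsNoetherian A (integralClosure A D) := by
  -- Noether normalization: the polynomial ring `P` is integrally closed, so its integral closure in
  -- a finite separable extension of `Frac P` is noetherian.
  obtain ⟨n, g, hg, hfin⟩ := exists_finite_inj_algHom_of_fg k A
  let P := MvPolynomial (Fin n) k
  algebraize [g.toRingHom, (algebraMap A D).comp g.toRingHom]
  have : Module.Finite P A := hfin
  have : FaithfulSMul P A := (faithfulSMul_iff_algebraMap_injective _ _).mpr hg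
  have : FaithfulSMul P D := .trans P A D
  have : Algebra.FiniteType P D := .trans (S := A) inferInstance inferInstance
  obtain ⟨L, _, _, _, _, _, ⟨f⟩⟩ := exists_algHom_finite_fractionRing P D
  have : CharZero (FractionRing P) := charZero_of_injective_algebraMap (R := P)
    (IsFractionRing.injective _ _)
  have : Algebra.IsSeparable (FractionRing P) L :=
    Algebra.IsAlgebraic.isSeparable_of_perfectField
  have : IsNoetherian P (integralClosure P L) :=
    IsIntegralClosure.isNoetherian P (FractionRing P) L _
  have hPL : Function.Injective (algebraMap P L) := by
    rw [IsScalarTower.algebraMap_eq P (FractionRing P) L]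
    exact (algebraMap (FractionRing P) L).injective.comp (IsFractionRing.injective _ _)
  have hint (x : integralClosure A D) : IsIntegral P (x : D) := isIntegral_trans (A := A) _ x.2
  let φ : integralClosure A D →ₗ[P] integralClosure P L :=
    { toFun x := ⟨f x, (hint x).map f⟩
      map_add' x y := by ext; simp
      map_smul' x y := by ext; simp }
  -- The map `f` itself need not be injective. Its kernel on the integral closure contracts to zero
  -- in `P`, and in a domain integral over `P` such an ideal is zero.
  have hφ : Function.Injective φ := by
    let ψ : integralClosure A D →+* L := f.toRingHom.comp (integralClosure A D).val.toRingHom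
    have hψ : Function.Injective ψ := by
      rw [RingHom.injective_iff_ker_eq_bot]
      have : Algebra.IsIntegral P (integralClosure A D) :=
        Algebra.IsIntegral.trans A
      apply Ideal.eq_bot_of_comap_eq_bot (R := P)
      rw [RingHom.comap_ker, ← RingHom.injective_iff_ker_eq_bot]
      convert hPL
      exact RingHom.ext fun x ↦ f.commutes x
    intro x y h
    exact hψ congr($(h).1)
  have : IsNoetherian P (integralClosure A D) :=
    isNoetherian_of_injective φ hφ
  exact isNoetherian_of_tower P this

/-! ### Finite presentations of modules, from affine opens to the whole scheme. -/

/-- Serves to compute the action of `Γ(X, U)` on a module restricted along `fromSpec` in terms of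
restriction maps of `X`. -/
theorem appIso_fromSpec_inv {X : Scheme.{u}} {U : X.Opens} (hU : IsAffineOpen U)
    (V : (Spec Γ(X, U)).Opens) (hV : hU.fromSpec ''ᵁ V ≤ U) :
    (Scheme.ΓSpecIso Γ(X, U)).inv ≫ (Spec Γ(X, U)).presheaf.map V.leTop.op ≫
      (hU.fromSpec.appIso V).inv = X.presheaf.map (homOfLE hV).op := by
  have h : V ≤ hU.fromSpec ⁻¹ᵁ U := by simp
  have : (Scheme.ΓSpecIso Γ(X, U)).inv ≫ (Spec Γ(X, U)).presheaf.map V.leTop.op =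
      hU.fromSpec.appLE U V h := by
    rw [Scheme.Hom.appLE, hU.fromSpec_app_self, Category.assoc, ← Functor.map_comp]
    rfl
  rw [← Category.assoc, this, Scheme.Hom.appLE_appIso_inv]

theorem exists_presentation_of_isIso {X : Scheme.{u}} {M N : X.Modules} (f : M ⟶ N)
    (hf : IsIso f) (P : M.Presentation) [hP : P.IsFinite] : ∃ Q : N.Presentation, Q.IsFinite := by
  have : @IsIso (SheafOfModules X.ringCatSheaf) _ M N f := hf
  exact ⟨P.ofIsIso (R := X.ringCatSheaf) (N := N) f,
    ⟨⟨hP.isFiniteType_generators.finite⟩, ⟨hP.isFiniteType_relations.finite⟩⟩⟩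

theorem exists_presentation_restrict {X Y : Scheme.{u}} (f : Y ⟶ X) [IsOpenImmersion f]
    {M : X.Modules} (P : M.Presentation) [hP : P.IsFinite] :
    ∃ Q : (M.restrict f).Presentation, Q.IsFinite :=
  ⟨Scheme.Modules.presentationRestrict f P,
    ⟨⟨hP.isFiniteType_generators.finite⟩, ⟨hP.isFiniteType_relations.finite⟩⟩⟩

/-- A localizing module is the tilde of its global sections. Finitely many of these generate, and
the relations between them are finitely generated because `R` is noetherian. -/
theorem exists_presentation_isFinite {R : CommRingCat.{u}} [IsNoetherianRing R]
    (N : (Spec R).Modules) (hloc : IsLocalizing (modulesSpecToSheaf.obj N))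
    (hfin : Module.Finite R Γ(N, ⊤)) : ∃ P : N.Presentation, P.IsFinite := by
  have hiso := (isIso_fromTildeΓ_iff_isLocalizing N).mpr hloc
  let T : ModuleCat R := (modulesSpecToSheaf.obj N).presheaf.obj (.op ⊤)
  have hT : Module.Finite R T := hfin
  obtain ⟨s, hs⟩ := hT.fg_top
  obtain ⟨t, ht⟩ : (LinearMap.ker (Finsupp.linearCombination R
    (fun x : (s : Set T) ↦ (x : T)))).FG := IsNoetherian.noetherian _
  let P : (tilde T).Presentation := presentationTilde T (s : Set T) hs (t : Set _) ht
  have : P.IsFinite :=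
    { isFiniteType_generators := ⟨inferInstanceAs (Finite s)⟩
      isFiniteType_relations := ⟨inferInstanceAs (Finite t)⟩ }
  exact exists_presentation_of_isIso N.fromTildeΓ hiso P

theorem exists_presentation_map {C C' : Type u} [Category.{u} C] [Category.{u} C']
    {J : GrothendieckTopology C} {R : Sheaf J RingCat.{u}}
    {J' : GrothendieckTopology C'} {S : Sheaf J' RingCat.{u}}
    [HasSheafify J AddCommGrpCat.{u}] [J.WEqualsLocallyBijective AddCommGrpCat.{u}]
    [HasSheafify J' AddCommGrpCat.{u}] [J'.WEqualsLocallyBijective AddCommGrpCat.{u}]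
    (F : SheafOfModules.{u} R ⥤ SheafOfModules.{u} S)
    [Limits.PreservesColimitsOfSize.{u, u} F]
    (η : SheafOfModules.unit S ≅ F.obj (.unit R))
    {M : SheafOfModules.{u} R} {N : SheafOfModules.{u} S} (e : F.obj M ≅ N)
    (P : M.Presentation) [hP : P.IsFinite] : ∃ P : N.Presentation, P.IsFinite := by
  have : (P.map F η).IsFinite :=
    { isFiniteType_generators := ⟨inferInstanceAs (Finite P.generators.I)⟩
      isFiniteType_relations := ⟨inferInstanceAs (Finite P.relations.I)⟩ }
  exact ⟨(P.map F η).ofIsIso e.hom, inferInstance⟩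

/-- Finite presentation is defined on the slice sites `M.over U`, so the presentation is carried
from `Spec Γ(X, U)` to the open subscheme `U` and then to the slice. -/
theorem isFinitePresentation_of_presentation {X : Scheme.{0}} (M : X.Modules)
    (h : ∀ (U : X.Opens) (hU : IsAffineOpen U),
      ∃ P : (M.restrict hU.fromSpec).Presentation, P.IsFinite) :
    SheafOfModules.IsFinitePresentation.{0} M := by
  have key (U : X.Opens) (hU : IsAffineOpen U) :
      ∃ P : (SheafOfModules.over M U).Presentation, P.IsFinite := by
    obtain ⟨P, hP⟩ := h U hU
    have h1 : hU.isoSpec.hom ≫ hU.fromSpec = U.ι := by simp [IsAffineOpen.isoSpec_hom]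
    let iso : (M.restrict hU.fromSpec).restrict hU.isoSpec.hom ≅ M.restrict U.ι :=
      (Scheme.Modules.restrictFunctorComp hU.isoSpec.hom hU.fromSpec).symm.app M ≪≫
      (Scheme.Modules.restrictFunctorCongr h1).app M
    obtain ⟨Q', hQ'⟩ := exists_presentation_restrict hU.isoSpec.hom P
    obtain ⟨Q, hQ⟩ := exists_presentation_of_isIso iso.hom inferInstance Q'
    let e1 := (Scheme.Modules.overFunctorEquiv U).app M
    let E := Scheme.Modules.overEquiv U
    let e2 : E.inverse.obj (M.restrict U.ι) ≅ SheafOfModules.over M U :=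
      E.inverse.mapIso e1.symm ≪≫ E.unitIso.symm.app _
    have hE : Limits.PreservesColimitsOfSize.{0, 0} E.inverse := inferInstance
    have : @Limits.PreservesColimitsOfSize.{0, 0} (SheafOfModules U.toScheme.ringCatSheaf) _
      (SheafOfModules (X.ringCatSheaf.over U)) _ E.inverse := hE
    exact @exists_presentation_map _ _ _ _ _ _ _ _ _ _ _ _ E.inverse this
      (Opens.sheafOfModulesEquivOverInverseUnit _ _).symm _ _ e2 Q hQ
  choose P hP using key
  let σ : SheafOfModules.QuasicoherentData.{0} (R := X.ringCatSheaf) M :=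
    { I := X.affineOpens
      X := fun U ↦ U.1
      coversTop := by
        rw [Opens.coversTop_iff]
        exact iSup_affineOpens_eq_top X
      presentation := fun U ↦ P U.1 U.2 }
  have hσ : σ.IsFinitePresentation :=
    @SheafOfModules.QuasicoherentData.IsFinitePresentation.mk _ _ _ _ _ _ _ σ
      fun (U : X.affineOpens) ↦ hP U.1 U.2
  exact ⟨σ, hσ⟩

/-! ### Coherence of localizing algebras. -/

section Coherent

variable {X : Scheme.{0}} {F : TopCat.Presheaf CommRingCat.{0} X} (φ : X.presheaf ⟶ F)

/-- A presheaf of `𝒪_X`-algebras is localizing if its sections over a basic open subset `D(f)` of an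
affine open subset `U` are the localization at `f` of its sections over `U`. -/
structure IsLocalizingAlgebra : Prop where
  exists_map_eq {U : X.Opens} (hU : IsAffineOpen U) (f : Γ(X, U))
    (x : F.obj (op (X.basicOpen f))) : ∃ (n : ℕ) (t : F.obj (op U)),
      (F.map (homOfLE (X.basicOpen_le f)).op).hom t =
        (φ.app (op (X.basicOpen f))).hom
          ((X.presheaf.map (homOfLE (X.basicOpen_le f)).op).hom (f ^ n)) * x
  exists_mul_eq_zero {U : X.Opens} (hU : IsAffineOpen U) (f : Γ(X, U)) (t : F.obj (op U))
    (ht : (F.map (homOfLE (X.basicOpen_le f)).op).hom t = 0) :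
    ∃ n : ℕ, (φ.app (op U)).hom (f ^ n) * t = 0

variable {φ}

theorem isSheaf_toPresheafOfModules (hF : F.IsSheaf) :
    Presheaf.IsSheaf (Opens.grothendieckTopology X) (toPresheafOfModules φ).presheaf := by
  have h1 := (TopCat.Presheaf.isSheaf_iff_isSheaf_comp (forget CommRingCat) F).mp hF
  exact (TopCat.Presheaf.isSheaf_iff_isSheaf_comp (forget AddCommGrpCat)
    (toPresheafOfModules φ).presheaf).mpr h1

variable (φ) in
/-- The sheaf of `𝒪_X`-modules underlying a sheaf of `𝒪_X`-algebras. -/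
def toModules (hF : F.IsSheaf) : X.Modules :=
  ⟨toPresheafOfModules φ, isSheaf_toPresheafOfModules hF⟩

theorem toModules_restrict_fromSpec_smul (hF : F.IsSheaf) {U : X.Opens} (hU : IsAffineOpen U)
    (V : (Spec Γ(X, U)).Opens) (hV : hU.fromSpec ''ᵁ V ≤ U) (r : Γ(X, U))
    (x : Γ((toModules φ hF).restrict hU.fromSpec, V)) :
    (r • x : Γ((toModules φ hF).restrict hU.fromSpec, V)) =
      HMul.hMul (α := F.obj (op (hU.fromSpec ''ᵁ V))) (β := F.obj (op (hU.fromSpec ''ᵁ V)))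
        ((φ.app (op (hU.fromSpec ''ᵁ V))).hom ((X.presheaf.map (homOfLE hV).op).hom r)) x := by
  rw [Scheme.Modules.smul_Spec_def, ← appIso_fromSpec_inv hU V hV]
  rfl

theorem IsLocalizingAlgebra.isLocalizing_restrict (h : IsLocalizingAlgebra φ) (hF : F.IsSheaf)
    {U : X.Opens} (hU : IsAffineOpen U) :
    IsLocalizing (modulesSpecToSheaf.obj ((toModules φ hF).restrict hU.fromSpec)) := by
  intro f
  let N := (toModules φ hF).restrict hU.fromSpec
  have h1 : hU.fromSpec ''ᵁ ⊤ = U := by simp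
  have h2 : hU.fromSpec ''ᵁ (PrimeSpectrum.basicOpen f) = X.basicOpen f :=
    hU.fromSpec_image_basicOpen f
  -- The images of `⊤` and `D(f)` under `fromSpec` equal `U` and `X.basicOpen f` only
  -- propositionally; generalizing both allows substitution.
  have key : ∀ (V W : X.Opens) (hV : V = U) (hW : W = X.basicOpen f) (hWV : W ≤ V)
      (hVU : V ≤ U) (hWU : W ≤ U),
      (∀ x : F.obj (op W), ∃ (n : ℕ) (t : F.obj (op V)), (F.map (homOfLE hWV).op).hom t =
        (φ.app (op W)).hom ((X.presheaf.map (homOfLE hWU).op).hom (f ^ n)) * x) ∧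
      (∀ t : F.obj (op V), (F.map (homOfLE hWV).op).hom t = 0 →
        ∃ n : ℕ, (φ.app (op V)).hom ((X.presheaf.map (homOfLE hVU).op).hom (f ^ n)) * t = 0) := by
    rintro V W rfl rfl hWV hVU hWU
    refine ⟨h.exists_map_eq hU f, fun t ht ↦ ?_⟩
    obtain ⟨n, hn⟩ := h.exists_mul_eq_zero hU f t ht
    refine ⟨n, ?_⟩
    have : (homOfLE hVU).op = 𝟙 _ := rfl
    rw [this, X.presheaf.map_id]
    exact hn
  obtain ⟨k1, k2⟩ := key _ _ h1 h2 (hU.fromSpec.image_mono le_top) h1.le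
    (h2.trans_le (X.basicOpen_le f))
  refine IsLocalizedModule.Away.mk_of_addCommGroup ?_ ?_ ?_
  · exact N.isUnit_algebraMap_end_of_le_basicOpen f le_rfl
  · intro x
    obtain ⟨n, t, ht⟩ := k1 x
    refine ⟨n, t, ?_⟩
    exact (toModules_restrict_fromSpec_smul hF hU _
      (h2.trans_le (X.basicOpen_le f)) (f ^ n) x).trans ht.symm
  · intro x hx
    obtain ⟨n, hn⟩ := k2 x hx
    refine ⟨n, ?_⟩
    exact (toModules_restrict_fromSpec_smul hF hU _ h1.le (f ^ n) x).trans hn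

theorem finite_restrict_fromSpec (hF : F.IsSheaf) {U : X.Opens} (hU : IsAffineOpen U)
    (hfin : (φ.app (op U)).hom.Finite) :
    Module.Finite Γ(X, U) Γ((toModules φ hF).restrict hU.fromSpec, ⊤) := by
  have h1 : hU.fromSpec ''ᵁ ⊤ = U := by simp
  let := (φ.app (op U)).hom.toAlgebra
  have : Module.Finite Γ(X, U) (F.obj (op U)) := hfin
  let ψ : F.obj (op U) →ₗ[Γ(X, U)] Γ((toModules φ hF).restrict hU.fromSpec, ⊤) :=
    { toFun x := (F.map (homOfLE h1.le).op).hom x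
      map_add' := fun x y ↦ (F.map (homOfLE h1.le).op).hom.map_add x y
      map_smul' := fun r x ↦ by
        refine Eq.trans ?_ (toModules_restrict_fromSpec_smul hF hU _ h1.le r _).symm
        refine (map_mul (F.map (homOfLE h1.le).op).hom ((φ.app (op U)).hom r) x).trans ?_
        exact congr($((φ.naturality (homOfLE h1.le).op).symm) r * _) }
  refine Module.Finite.of_surjective ψ fun x ↦ ?_
  refine ⟨(F.map (homOfLE h1.ge).op).hom x, ?_⟩
  change (F.map (homOfLE h1.ge).op ≫ F.map (homOfLE h1.le).op).hom x = x
  rw [← F.map_comp]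
  exact congr($(F.map_id (op (hU.fromSpec ''ᵁ ⊤))).hom x)

theorem isCoherent_of_isFinitePresentation (M : SheafOfModules X.ringCatSheaf)
    [SheafOfModules.IsFinitePresentation.{0} M] : IsCoherent (X := X) M :=
  ⟨inferInstanceAs (SheafOfModules.IsQuasicoherent.{0} M),
    inferInstanceAs (SheafOfModules.IsFiniteType.{0} M)⟩

/-- A localizing sheaf of `𝒪_X`-algebras whose sections over affine open subsets are finite is
coherent. -/
theorem IsLocalizingAlgebra.isCoherentSheaf [IsLocallyNoetherian X] (h : IsLocalizingAlgebra φ)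
    (hF : F.IsSheaf) (hfin : ∀ U, IsAffineOpen U → (φ.app (op U)).hom.Finite) :
    IsCoherentSheaf (toPresheafOfModules φ) := by
  have : SheafOfModules.IsFinitePresentation.{0} (toModules φ hF) := by
    refine isFinitePresentation_of_presentation _ fun U hU ↦ ?_
    have : IsNoetherianRing Γ(X, U) := IsLocallyNoetherian.component_noetherian ⟨U, hU⟩
    exact exists_presentation_isFinite _ (h.isLocalizing_restrict hF hU)
      (finite_restrict_fromSpec hF hU (hfin U hU))
  exact ⟨isSheaf_toPresheafOfModules hF, @isCoherent_of_isFinitePresentation _ _ this⟩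

end Coherent

/-! ### Relative spectrum of a localizing algebra and morphisms to it. -/

section RelativeSpec

open Limits Scheme.AffineZariskiSite

variable {X : Scheme.{0}} {F : TopCat.Presheaf CommRingCat.{0} X} {φ : X.presheaf ⟶ F}

/-- This is the gluing condition for the `Spec F(U)`: since `F(D(r))` is the localization of `F(U)`
at `r`, its spectrum is the open part lying over `D(r)`. -/
theorem IsLocalizingAlgebra.coequifibered (h : IsLocalizingAlgebra φ) :
    ((toOpensFunctor X).op.whiskerLeft φ).Coequifibered := by
  refine coequifibered_iff_forall_isLocalizationAway.mpr fun ⟨U, hU⟩ r ↦ ?_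
  change Γ(X, U) at r
  let : Algebra (F.obj (op U)) (F.obj (op (X.basicOpen r))) :=
    (F.map (homOfLE (X.basicOpen_le r)).op).hom.toAlgebra
  have hnat (a : Γ(X, U)) : algebraMap (F.obj (op U)) (F.obj (op (X.basicOpen r)))
      ((φ.app (op U)).hom a) = (φ.app (op (X.basicOpen r))).hom
        ((X.presheaf.map (homOfLE (X.basicOpen_le r)).op).hom a) :=
    congr($(φ.naturality (homOfLE (X.basicOpen_le r)).op) a).symm
  change IsLocalization.Away ((φ.app (op U)).hom r) (F.obj (op (X.basicOpen r)))
  have hmap : ∀ y, algebraMap (F.obj (op U)) (F.obj (op (X.basicOpen r))) y =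
    (F.map (homOfLE (X.basicOpen_le r)).op).hom y := fun _ ↦ rfl
  refine ⟨⟨?_, ?_, ?_⟩⟩
  · rintro ⟨_, n, rfl⟩
    change IsUnit (algebraMap _ _ ((φ.app (op U)).hom r ^ n))
    rw [map_pow, hnat]
    exact ((X.toRingedSpace.isUnit_res_basicOpen r).map _).pow n
  · intro x
    obtain ⟨n, t, ht⟩ := h.exists_map_eq hU r x
    refine ⟨⟨t, ⟨_, n, rfl⟩⟩, ?_⟩
    change x * (algebraMap _ _ ((φ.app (op U)).hom r ^ n)) = algebraMap _ _ t
    rw [hmap t, ht, mul_comm, ← map_pow, hnat]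
  · intro x y hxy
    obtain ⟨n, hn⟩ := h.exists_mul_eq_zero hU r (x - y)
      (by rw [map_sub, ← hmap, ← hmap, hxy, sub_self])
    refine ⟨⟨_, n, rfl⟩, ?_⟩
    change (φ.app (op U)).hom r ^ n * x = (φ.app (op U)).hom r ^ n * y
    rwa [map_pow, mul_sub, sub_eq_zero] at hn

variable (H : ((toOpensFunctor X).op.whiskerLeft φ).Coequifibered)

/-- The diagram of affine schemes that we glue to form the relative spectrum. -/
def relSpecGlueData := relativeGluingData H

instance : ((relSpecGlueData H).functor ⋙ Scheme.forget).IsLocallyDirected :=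
  Scheme.Cover.RelativeGluingData.instIsLocallyDirectedI₀CompFunctorForgetOfIsThin ..

/-- The relative spectrum of a localizing `𝒪_X`-algebra. -/
def relSpec : Scheme.{0} := (relSpecGlueData H).glued

/-- The structure morphism of the relative spectrum. -/
def relSpecMap : relSpec H ⟶ X := (relSpecGlueData H).toBase

/-- The inclusion of the spectrum of the sections over an affine open subset into the relative
spectrum. -/
def relSpecι {U : X.Opens} (hU : IsAffineOpen U) : Spec (F.obj (op U)) ⟶ relSpec H :=
  (relSpecGlueData H).cover.f ⟨U, hU⟩

instance {U : X.Opens} (hU : IsAffineOpen U) : IsOpenImmersion (relSpecι H hU) :=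
  (relSpecGlueData H).cover.map_prop ⟨U, hU⟩

theorem map_relSpecι {U V : X.AffineZariskiSite} (i : U ⟶ V) :
    Spec.map (F.map (homOfLE (toOpens_mono i.le)).op) ≫ relSpecι H V.2 = relSpecι H U.2 :=
  colimit.w (relSpecGlueData H).functor i

theorem relSpecι_map {U : X.Opens} (hU : IsAffineOpen U) :
    relSpecι H hU ≫ relSpecMap H = Spec.map (φ.app (op U)) ≫ hU.fromSpec :=
  colimit.ι_desc _ _

theorem relSpecMap_preimage {U : X.Opens} (hU : IsAffineOpen U) :
    relSpecMap H ⁻¹ᵁ U = (relSpecι H hU).opensRange := by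
  simpa using! (relSpecGlueData H).toBase_preimage_eq_opensRange_ι ⟨U, hU⟩

theorem relSpecι_preimage {U : X.Opens} (hU : IsAffineOpen U) :
    relSpecι H hU ⁻¹ᵁ relSpecMap H ⁻¹ᵁ U = ⊤ := by
  rw [relSpecMap_preimage H hU, Scheme.Hom.preimage_opensRange]

/-- The sections of the relative spectrum over the preimage of an affine open subset are the
sections of the algebra. -/
def relSpecObjHom {U : X.Opens} (hU : IsAffineOpen U) :
    Γ(relSpec H, relSpecMap H ⁻¹ᵁ U) ⟶ F.obj (op U) :=
  (relSpecι H hU).appLE (relSpecMap H ⁻¹ᵁ U) ⊤ (relSpecι_preimage H hU).ge ≫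
    (Scheme.ΓSpecIso _).hom

instance isIso_relSpecObjHom {U : X.Opens} (hU : IsAffineOpen U) :
    IsIso (relSpecObjHom H hU) := by
  have : IsIso ((relSpecι H hU).app (relSpecMap H ⁻¹ᵁ U)) :=
    Scheme.Hom.isIso_app _ _ (relSpecMap_preimage H hU).le
  have : IsIso ((Spec (F.obj (op U))).presheaf.map
      (homOfLE (relSpecι_preimage H hU).ge).op) := by
    rw [show homOfLE (relSpecι_preimage H hU).ge = eqToHom (relSpecι_preimage H hU).symm from rfl]
    infer_instance
  have : IsIso ((relSpecι H hU).appLE (relSpecMap H ⁻¹ᵁ U) ⊤ (relSpecι_preimage H hU).ge) := by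
    rw [Scheme.Hom.appLE]
    exact IsIso.comp_isIso
  exact IsIso.comp_isIso

theorem app_relSpecObjHom {U : X.Opens} (hU : IsAffineOpen U) :
    (relSpecMap H).app U ≫ relSpecObjHom H hU = φ.app (op U) := by
  rw [relSpecObjHom, Scheme.Hom.app_eq_appLE, Scheme.Hom.appLE_comp_appLE_assoc]
  have key (g : Spec (F.obj (op U)) ⟶ X) (hg : g = Spec.map (φ.app (op U)) ≫ hU.fromSpec)
      (h : ⊤ ≤ g ⁻¹ᵁ U) : g.appLE U ⊤ h ≫ (Scheme.ΓSpecIso _).hom = φ.app (op U) := by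
    subst hg
    have e1 : ⊤ ≤ hU.fromSpec ⁻¹ᵁ U := hU.fromSpec_preimage_self.ge
    rw [← Scheme.Hom.appLE_comp_appLE _ _ U ⊤ ⊤ e1 le_rfl, Category.assoc]
    have e2 : hU.fromSpec.appLE U ⊤ e1 = (Scheme.ΓSpecIso _).inv := by
      rw [Scheme.Hom.appLE, hU.fromSpec_app_self, Category.assoc, ← Functor.map_comp]
      exact (congrArg _ ((Spec Γ(X, U)).presheaf.map_id _)).trans (Category.comp_id _)
    have e3 : (Spec.map (φ.app (op U))).appLE ⊤ ⊤ le_rfl = (Spec.map (φ.app (op U))).appTop :=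
      Scheme.Hom.appLE_eq_app _
    rw [e2, e3, Scheme.ΓSpecIso_naturality, Iso.inv_hom_id_assoc]
  exact key _ (relSpecι_map H hU) _

theorem isFinite_relSpecMap (hfin : ∀ U, IsAffineOpen U → (φ.app (op U)).hom.Finite) :
    IsFinite (relSpecMap H) where
  isAffine_preimage U hU := by
    rw [relSpecMap_preimage H hU]
    exact isAffineOpen_opensRange _
  finite_app U hU := by
    have h := app_relSpecObjHom H hU
    rw [← IsIso.eq_comp_inv] at h
    rw [h, CommRingCat.hom_comp]
    refine RingHom.Finite.comp (.of_surjective _ ?_) (hfin U hU)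
    exact (ConcreteCategory.bijective_of_isIso (inv (relSpecObjHom H hU))).2

section Factorization

variable {Y : Scheme.{0}} {f : Y ⟶ X}
  (ψ : F ⟶ (TopCat.Presheaf.pushforward CommRingCat f.base).obj Y.presheaf)

/-- The restriction of `toRelSpec` to the preimage of an affine open subset. -/
def toRelSpecAux {U : X.Opens} (hU : IsAffineOpen U) : pullback f U.ι ⟶ relSpec H :=
  (pullbackRestrictIsoRestrict f U).hom ≫
    (f ⁻¹ᵁ U).toSpecΓ ≫ Spec.map (ψ.app (op U)) ≫ relSpecι H hU

theorem comp_toRelSpecAux {U V : X.AffineZariskiSite} (i : U ⟶ V)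
    (t : pullback f U.1.ι ⟶ pullback f V.1.ι) (ht : t ≫ pullback.fst _ _ = pullback.fst _ _) :
    t ≫ toRelSpecAux H ψ V.2 = toRelSpecAux H ψ U.2 := by
  obtain ⟨U, hU⟩ := U
  obtain ⟨V, hV⟩ := V
  have hUV : U ≤ V := toOpens_mono i.le
  have h1 : t ≫ (pullbackRestrictIsoRestrict f V).hom =
      (pullbackRestrictIsoRestrict f U).hom ≫ Y.homOfLE (f.preimage_mono hUV) := by
    rw [← cancel_mono (Scheme.Opens.ι _)]
    simpa using ht
  have h3 : ψ.app (op V) ≫ Y.presheaf.map (homOfLE (f.preimage_mono hUV)).op =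
    F.map (homOfLE hUV).op ≫ ψ.app (op U) := (ψ.naturality (homOfLE hUV).op).symm
  have h2 : Y.homOfLE (f.preimage_mono hUV) ≫ (f ⁻¹ᵁ V).toSpecΓ ≫
      Spec.map (ψ.app (op V)) ≫ relSpecι H hV =
      (f ⁻¹ᵁ U).toSpecΓ ≫ Spec.map (ψ.app (op U)) ≫ relSpecι H hU := by
    rw [show relSpecι H hU = Spec.map (F.map (homOfLE hUV).op) ≫ relSpecι H hV from
      (map_relSpecι H i).symm, ← Scheme.Opens.toSpecΓ_SpecMap_presheaf_map_assoc]
    change _ ≫ _ ≫ Spec.map (ψ.app (op V)) ≫ _ = _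
    rw [← Spec.map_comp_assoc (ψ.app (op V)), ← Spec.map_comp_assoc (F.map _), h3]
  unfold toRelSpecAux
  rw [← Category.assoc t, h1, Category.assoc, h2]

theorem trans_toRelSpecAux {U V : X.AffineZariskiSite} (i : U ⟶ V) :
    Scheme.Cover.trans ((directedCover X).pullback₁ f) i ≫ toRelSpecAux H ψ V.2 =
      toRelSpecAux H ψ U.2 :=
  comp_toRelSpecAux H ψ i _ (Scheme.Cover.trans_map ((directedCover X).pullback₁ f) i)

/-- The morphism to the relative spectrum of `F` induced by a morphism of algebras. -/
def toRelSpec : Y ⟶ relSpec H :=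
  Scheme.OpenCover.glueMorphismsOfLocallyDirected ((directedCover X).pullback₁ f)
    (fun U : X.AffineZariskiSite ↦ toRelSpecAux H ψ U.2) (trans_toRelSpecAux H ψ)

theorem ι_toRelSpec {U : X.Opens} (hU : IsAffineOpen U) :
    (f ⁻¹ᵁ U).ι ≫ toRelSpec H ψ =
      (f ⁻¹ᵁ U).toSpecΓ ≫ Spec.map (ψ.app (op U)) ≫ relSpecι H hU := by
  rw [← cancel_epi (pullbackRestrictIsoRestrict f U).hom, ← Category.assoc]
  rw [pullbackRestrictIsoRestrict_hom_ι]
  exact Scheme.OpenCover.map_glueMorphismsOfLocallyDirected ((directedCover X).pullback₁ f)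
    (fun U : X.AffineZariskiSite ↦ toRelSpecAux H ψ U.2) (trans_toRelSpecAux H ψ) ⟨U, hU⟩

theorem toRelSpec_relSpecMap (hψ : φ ≫ ψ = f.c) : toRelSpec H ψ ≫ relSpecMap H = f := by
  refine Scheme.Cover.hom_ext (Y.openCoverOfIsOpenCover _
    (.comap (iSup_affineOpens_eq_top X) f.base.1)) _ _ fun (U : X.affineOpens) ↦ ?_
  obtain ⟨U, hU⟩ := U
  change IsAffineOpen U at hU
  change (f ⁻¹ᵁ U).ι ≫ toRelSpec H ψ ≫ relSpecMap H = (f ⁻¹ᵁ U).ι ≫ f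
  rw [← Category.assoc, ι_toRelSpec H ψ hU, Category.assoc, Category.assoc, relSpecι_map,
    ← Spec.map_comp_assoc]
  have : φ.app (op U) ≫ ψ.app (op U) = f.app U := congr($(hψ).app (op U))
  rw [this]
  change (f ⁻¹ᵁ U).toSpecΓ ≫ Spec.map (f.app _) ≫ IsAffineOpen.fromSpec hU = _
  simp

/-- Over affine opens, pullback along `toRelSpec` is `ψ` itself once functions on the relative
spectrum are identified with sections of `F`. -/
theorem appLE_toRelSpec {U : X.Opens} (hU : IsAffineOpen U)
    (h : f ⁻¹ᵁ U ≤ toRelSpec H ψ ⁻¹ᵁ relSpecMap H ⁻¹ᵁ U) :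
    (toRelSpec H ψ).appLE _ _ h = relSpecObjHom H hU ≫ ψ.app (op U) := by
  let Ψ : F.obj (op U) ⟶ Γ(Y, f ⁻¹ᵁ U) := ψ.app (op U)
  change _ = relSpecObjHom H hU ≫ Ψ
  have e0 : ⊤ ≤ (f ⁻¹ᵁ U).ι ⁻¹ᵁ (f ⁻¹ᵁ U) := by simp
  have e1 : (f ⁻¹ᵁ U).ι.appLE (f ⁻¹ᵁ U) ⊤ e0 = (f ⁻¹ᵁ U).topIso.inv := by
    rw [Scheme.Opens.ι_appLE]
    rfl
  have key (g : (f ⁻¹ᵁ U).toScheme ⟶ relSpec H)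
      (hg : g = (f ⁻¹ᵁ U).toSpecΓ ≫ Spec.map Ψ ≫ relSpecι H hU)
      (h : ⊤ ≤ g ⁻¹ᵁ relSpecMap H ⁻¹ᵁ U) :
      g.appLE _ ⊤ h = relSpecObjHom H hU ≫ Ψ ≫ (f ⁻¹ᵁ U).topIso.inv := by
    subst hg
    have e2 : ⊤ ≤ (Spec.map Ψ ≫ relSpecι H hU) ⁻¹ᵁ relSpecMap H ⁻¹ᵁ U := by
      rw [Scheme.Hom.comp_preimage, relSpecι_preimage]
      exact le_rfl
    rw [← Scheme.Hom.appLE_comp_appLE _ _ _ ⊤ ⊤ e2 le_rfl,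
      ← Scheme.Hom.appLE_comp_appLE _ _ _ ⊤ ⊤ (relSpecι_preimage H hU).ge le_rfl,
      show (Spec.map Ψ).appLE ⊤ ⊤ le_rfl = (Spec.map Ψ).appTop from Scheme.Hom.appLE_eq_app _,
      show (f ⁻¹ᵁ U).toSpecΓ.appLE ⊤ ⊤ le_rfl = (f ⁻¹ᵁ U).toSpecΓ.appTop from
        Scheme.Hom.appLE_eq_app _, Scheme.Opens.toSpecΓ_appTop, relSpecObjHom, Category.assoc,
      Category.assoc, ← Scheme.ΓSpecIso_naturality_assoc]
  rw [← cancel_mono (f ⁻¹ᵁ U).topIso.inv, ← e1, Scheme.Hom.appLE_comp_appLE, Category.assoc, e1]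
  exact key _ (ι_toRelSpec H ψ hU) _

end Factorization

end RelativeSpec

/-! ### Quasi-coherent subalgebras. -/

section LocalSubalgebra

variable {X : Scheme.{0}} {F : TopCat.Presheaf CommRingCat.{0} X} {φ : X.presheaf ⟶ F}

namespace SubalgebraPresheaf

/-- A subalgebra of an algebra over the structure sheaf is a quasi-coherent subsheaf if membership
is a local condition and every section over a basic open subset of an affine open subset extends
after multiplication by a power of the defining equation. -/
structure IsQuasicoherentSubsheaf (S : SubalgebraPresheaf φ) : Prop where
  mem_of_locally {U : X.Opens} (f : F.obj (op U)) (h : ∀ x ∈ U, ∃ (V : X.Opens) (hV : V ≤ U),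
    x ∈ V ∧ (F.map (homOfLE hV).op).hom f ∈ S.obj (op V)) : f ∈ S.obj (op U)
  exists_mem {U : X.Opens} (hU : IsAffineOpen U) (r : Γ(X, U)) (f : F.obj (op (X.basicOpen r)))
    (hf : f ∈ S.obj (op (X.basicOpen r))) : ∃ n : ℕ, ∃ g ∈ S.obj (op U),
      (F.map (homOfLE (X.basicOpen_le r)).op).hom g = (φ.app (op (X.basicOpen r))).hom
        ((X.presheaf.map (homOfLE (X.basicOpen_le r)).op).hom (r ^ n)) * f

/-- The inclusion of a subalgebra. -/
def inclusion (S : SubalgebraPresheaf φ) : S.presheaf ⟶ F where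
  app U := CommRingCat.ofHom (S.obj U).subtype
  naturality _ _ _ := rfl

theorem structureMap_inclusion (S : SubalgebraPresheaf φ) : S.structureMap ≫ S.inclusion = φ := rfl

theorem inclusion_app_injective (S : SubalgebraPresheaf φ) (U : (Opens X)ᵒᵖ) :
    Function.Injective (S.inclusion.app U).hom := Subtype.val_injective

variable {S : SubalgebraPresheaf φ}

/-- Sections are glued in `F`, and the result stays in `S` because membership is local. -/
theorem IsQuasicoherentSubsheaf.isSheaf (hS : S.IsQuasicoherentSubsheaf) (hF : F.IsSheaf) :
    S.presheaf.IsSheaf := by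
  rw [TopCat.Presheaf.isSheaf_iff_isSheafUniqueGluing]
  intro ι U sf hsf
  obtain ⟨s, hs, hs'⟩ := hF.isSheafUniqueGluing U (fun i ↦ (sf i).1)
    (fun i j ↦ congrArg Subtype.val (hsf i j))
  refine ⟨⟨s, hS.mem_of_locally s fun x hx ↦ ?_⟩, fun i ↦ Subtype.ext (hs i), fun t ht ↦ ?_⟩
  · obtain ⟨i, hi⟩ := Opens.mem_iSup.mp hx
    refine ⟨U i, le_iSup U i, hi, ?_⟩
    have h := hs i
    change (F.map (homOfLE (le_iSup U i)).op).hom s = (sf i).1 at h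
    rw [h]
    exact (sf i).2
  · exact Subtype.ext (hs' t.1 fun i ↦ congrArg Subtype.val (ht i))

theorem IsQuasicoherentSubsheaf.isLocalizingAlgebra (hS : S.IsQuasicoherentSubsheaf)
    (hφ : ∀ {U : X.Opens} (_ : IsAffineOpen U) (r : Γ(X, U)) (t : F.obj (op U)),
      (F.map (homOfLE (X.basicOpen_le r)).op).hom t = 0 →
        ∃ n : ℕ, (φ.app (op U)).hom (r ^ n) * t = 0) :
    IsLocalizingAlgebra S.structureMap where
  exists_map_eq hU r x := by
    obtain ⟨n, g, hg, h⟩ := hS.exists_mem hU r x.1 x.2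
    exact ⟨n, ⟨g, hg⟩, Subtype.ext h⟩
  exists_mul_eq_zero hU r t ht := by
    obtain ⟨n, hn⟩ := hφ hU r t.1 (congrArg Subtype.val ht)
    exact ⟨n, Subtype.ext hn⟩

end SubalgebraPresheaf

end LocalSubalgebra

/-! ### Direct images and dominance. -/

section Pushforward

variable {X Y : Scheme.{0}} {π : Y ⟶ X}

theorem isSheaf_pushforward (π : Y ⟶ X) :
    ((TopCat.Presheaf.pushforward CommRingCat π.base).obj Y.presheaf).IsSheaf :=
  ((TopCat.Sheaf.pushforward CommRingCat π.base).obj Y.sheaf).property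

theorem exists_pow_mul_eq_zero_of_map_eq_zero [QuasiCompact π] {U : X.Opens} (hU : IsAffineOpen U)
    (r : Γ(X, U)) (t : Γ(Y, π ⁻¹ᵁ U))
    (ht : (Y.presheaf.map (homOfLE (π.preimage_mono (X.basicOpen_le r))).op).hom t = 0) :
    ∃ n : ℕ, (π.app U).hom (r ^ n) * t = 0 := by
  obtain ⟨n, hn⟩ := exists_pow_mul_eq_zero_of_res_basicOpen_eq_zero_of_isCompact Y
    (π.isCompact_preimage hU.isCompact) t ((π.app U).hom r) (by
      have e : Y.basicOpen ((π.app U).hom r) ≤ π ⁻¹ᵁ X.basicOpen r :=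
        (Scheme.preimage_basicOpen π r).ge
      have := congrArg (Y.presheaf.map (homOfLE e).op).hom ht
      rw [map_zero, ← CommRingCat.comp_apply, ← Functor.map_comp] at this
      exact this)
  exact ⟨n, by rwa [map_pow]⟩

theorem irreducibleSpace_of_isDominant (q : Y ⟶ X) [IsDominant q] [IrreducibleSpace Y] :
    IrreducibleSpace X := by
  rw [irreducibleSpace_def]
  convert! ((IrreducibleSpace.isIrreducible_univ Y).image _ q.continuous.continuousOn).closure
  simpa using q.denseRange.closure_range.symm

theorem isReduced_relSpec {F : TopCat.Presheaf CommRingCat.{0} X} {φ : X.presheaf ⟶ F}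
    (H : ((Scheme.AffineZariskiSite.toOpensFunctor X).op.whiskerLeft φ).Coequifibered)
    (h : ∀ U, _root_.IsReduced (F.obj (op U))) : IsReduced (relSpec H) := by
  have (i : _) : IsReduced ((relSpecGlueData H).cover.X i) := by
    have : _root_.IsReduced (F.obj (op i.toOpens)) := h _
    change IsReduced (Spec (F.obj (op i.toOpens)))
    infer_instance
  exact .of_openCover _ (relSpecGlueData H).cover

variable {Z : Scheme.{0}} {p : Z ⟶ X} {q : Y ⟶ Z}

/-- The morphism of direct images on `X` induced by a morphism over `X`. -/
def pushforwardHom (h : q ≫ p = π) :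
    (TopCat.Presheaf.pushforward CommRingCat p.base).obj Z.presheaf ⟶
      (TopCat.Presheaf.pushforward CommRingCat π.base).obj Y.presheaf where
  app U := q.appLE (p ⁻¹ᵁ U.unop) (π ⁻¹ᵁ U.unop) (by subst h; exact le_rfl)
  naturality U V i := by
    subst h
    exact (q.map_appLE _ _).trans (q.appLE_map _ _).symm

theorem c_pushforwardHom (h : q ≫ p = π) : p.c ≫ pushforwardHom h = π.c := by
  subst h
  ext U : 1
  change p.app U ≫ q.appLE _ _ _ = (q ≫ p).app U
  rw [Scheme.Hom.app_eq_appLE, Scheme.Hom.appLE_comp_appLE, Scheme.Hom.app_eq_appLE]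

/-- A nonempty open of `Z` contains a nonempty `D(g)` with `g` a function over an affine open. By
injectivity `g` pulls back to a nonzero function, and on the reduced scheme `Y` this is nonvanishing
somewhere, so `q` hits `D(g)`. -/
theorem isDominant_of_pushforwardHom_injective [IsAffineHom p] [IsReduced Y] [IsReduced Z]
    (hqp : q ≫ p = π) (h : ∀ U : X.Opens, IsAffineOpen U →
      Function.Injective ((pushforwardHom hqp).app (op U)).hom) :
    IsDominant q := by
  subst hqp
  replace h (U : X.Opens) (hU : IsAffineOpen U) : Function.Injective (q.app (p ⁻¹ᵁ U)).hom := by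
    rw [Scheme.Hom.app_eq_appLE]
    exact h U hU
  refine ⟨dense_iff_inter_open.mpr fun W hW ⟨z, hz⟩ ↦ ?_⟩
  obtain ⟨_, ⟨U, hU, rfl⟩, hzU, -⟩ := X.isBasis_affineOpens.exists_subset_of_mem_open
    (Set.mem_univ (p z)) isOpen_univ
  change IsAffineOpen U at hU
  change z ∈ p ⁻¹ᵁ U at hzU
  obtain ⟨g, hg, hzg⟩ := (hU.preimage p).exists_basicOpen_le (V := ⟨W, hW⟩) ⟨z, hz⟩ hzU
  have hg0 : (q.app (p ⁻¹ᵁ U)).hom g ≠ 0 := by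
    intro h0
    have := h U hU (h0.trans (map_zero _).symm)
    rw [this, Scheme.basicOpen_zero] at hzg
    exact hzg
  have hne : Y.basicOpen ((q.app (p ⁻¹ᵁ U)).hom g) ≠ ⊥ := fun hb ↦
    hg0 (basicOpen_eq_bot_iff _ |>.mp hb)
  obtain ⟨y, hy⟩ := (Opens.ne_bot_iff_nonempty _).mp hne
  have hy' : y ∈ q ⁻¹ᵁ Z.basicOpen g := (Scheme.preimage_basicOpen q g).ge hy
  exact ⟨q y, hg hy', y, rfl⟩

end Pushforward

/-! ### Relative spectrum of a finite quasi-coherent subalgebra. -/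

section RelativeSpecSubalgebra

variable {X Y : Scheme.{0}} {π : Y ⟶ X} [QuasiCompact π]
  {S : SubalgebraPresheaf π.c}

theorem SubalgebraPresheaf.IsQuasicoherentSubsheaf.isLocalizingAlgebra_pushforward
    (hS : S.IsQuasicoherentSubsheaf) : IsLocalizingAlgebra S.structureMap :=
  hS.isLocalizingAlgebra exists_pow_mul_eq_zero_of_map_eq_zero

/-- A quasi-coherent and finite subalgebra of `π_* 𝒪_Y` is coherent, and it is the direct image of
the structure sheaf of an integral scheme, finite over `X`, through which `π` factors. -/
theorem exists_relSpec [IsIntegral Y] [IsLocallyNoetherian X] (hS : S.IsQuasicoherentSubsheaf)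
    (hfin : ∀ U, IsAffineOpen U → (S.structureMap.app (op U)).hom.Finite) :
    IsCoherentSheaf (toPresheafOfModules S.structureMap) ∧
    ∃ (Z : Scheme.{0}) (p : Z ⟶ X) (q : Y ⟶ Z) (h : q ≫ p = π), IsIntegral Z ∧ IsFinite p ∧
      ∃ e : S.presheaf ≅ (TopCat.Presheaf.pushforward CommRingCat p.base).obj Z.presheaf,
        S.structureMap ≫ e.hom = p.c ∧ e.hom ≫ pushforwardHom h = S.inclusion := by
  have hloc := hS.isLocalizingAlgebra_pushforward
  have hSsh := hS.isSheaf (isSheaf_pushforward π)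
  refine ⟨hloc.isCoherentSheaf hSsh hfin, ?_⟩
  have H := hloc.coequifibered
  let p := relSpecMap H
  let q : Y ⟶ relSpec H := toRelSpec H S.inclusion
  have hqp : q ≫ p = π := toRelSpec_relSpecMap H S.inclusion S.structureMap_inclusion
  have hpfin : IsFinite p := isFinite_relSpecMap H hfin
  have happ {U : X.Opens} (hU : IsAffineOpen U) :
      (pushforwardHom hqp).app (op U) = relSpecObjHom H hU ≫ S.inclusion.app (op U) :=
    appLE_toRelSpec H S.inclusion hU _
  -- Over affine opens the pullback factors through `S` by `happ`; locality of membership extends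
  -- this to every open.
  have hmem (U : (Opens X)ᵒᵖ) (z : Γ(relSpec H, p ⁻¹ᵁ U.unop)) :
      ((pushforwardHom hqp).app U).hom z ∈ S.obj U := by
    refine hS.mem_of_locally (U := U.unop) _ fun x hx ↦ ?_
    obtain ⟨_, ⟨V, hV, rfl⟩, hxV, hVU⟩ :=
      X.isBasis_affineOpens.exists_subset_of_mem_open hx U.unop.isOpen
    refine ⟨V, hVU, hxV, ?_⟩
    have := congr($((pushforwardHom hqp).naturality (homOfLE hVU).op).hom z)
    rw [CommRingCat.hom_comp, CommRingCat.hom_comp, RingHom.comp_apply, RingHom.comp_apply] at this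
    erw [← this, happ hV]
    exact Subtype.property _
  let g : (TopCat.Presheaf.pushforward CommRingCat p.base).obj (relSpec H).presheaf ⟶ S.presheaf :=
    { app U := CommRingCat.ofHom
        (((pushforwardHom hqp).app U).hom.codRestrict (S.obj U) (hmem U))
      naturality U V i := by
        ext z
        apply Subtype.ext
        exact congr($((pushforwardHom hqp).naturality i) z) }
  have hg : g ≫ S.inclusion = pushforwardHom hqp := rfl
  have hgapp {U : X.Opens} (hU : IsAffineOpen U) : g.app (op U) = relSpecObjHom H hU := by
    ext z
    apply Subtype.ext
    exact congr($(happ hU) z)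
  have : Mono S.inclusion := by
    have (U : (Opens X)ᵒᵖ) : Mono (S.inclusion.app U) :=
      ConcreteCategory.mono_of_injective _ (S.inclusion_app_injective U)
    exact NatTrans.mono_of_mono_app _
  let G : (⟨_, isSheaf_pushforward p⟩ : TopCat.Sheaf CommRingCat X) ⟶ ⟨S.presheaf, hSsh⟩ := ⟨g⟩
  -- Both sides are sheaves, so it is enough to look at the affine opens, where `g` is
  -- `relSpecObjHom`.
  have hG : IsIso G := TopCat.Sheaf.isIso_iff_isIso_basis
    (B := fun U : X.affineOpens ↦ (U : X.Opens))
    (by simpa using X.isBasis_affineOpens) fun ⟨U, hU⟩ ↦ by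
      change IsIso (g.app (op U))
      rw [hgapp hU]
      exact isIso_relSpecObjHom H hU
  have hgiso : IsIso g :=
    @Functor.map_isIso _ _ _ _ _ _ (TopCat.Sheaf.forget _ _) G hG
  have hinj (U : (Opens X)ᵒᵖ) : Function.Injective ((pushforwardHom hqp).app U).hom := by
    have : IsIso (g.app U) := NatIso.isIso_app_of_isIso g U
    exact (S.inclusion_app_injective U).comp (ConcreteCategory.bijective_of_isIso (g.app U)).1
  -- Integrality of the relative spectrum: it is reduced since its rings embed in those of `Y`, and
  -- irreducible since `q` is dominant.
  have hred : IsReduced (relSpec H) := isReduced_relSpec H fun U ↦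
    have : _root_.IsReduced Γ(Y, π ⁻¹ᵁ U) := inferInstance
    isReduced_of_injective (S := Γ(Y, π ⁻¹ᵁ U)) (S.inclusion.app (op U)).hom
      (S.inclusion_app_injective _)
  have hdom : IsDominant q := isDominant_of_pushforwardHom_injective hqp fun U _ ↦ hinj (op U)
  have := irreducibleSpace_of_isDominant q
  refine ⟨relSpec H, p, q, hqp, isIntegral_of_irreducibleSpace_of_isReduced _, hpfin,
    (asIso g).symm, ?_, ?_⟩
  · rw [Iso.symm_hom, asIso_inv, IsIso.comp_inv_eq, ← cancel_mono S.inclusion, Category.assoc, hg,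
      c_pushforwardHom, S.structureMap_inclusion]
  · rw [Iso.symm_hom, asIso_inv, IsIso.inv_comp_eq, hg]

end RelativeSpecSubalgebra

/-! ### Integrality of sections and of germs. -/

section Germs

variable {X : Scheme.{0}} {F : TopCat.Presheaf CommRingCat.{0} X} {φ : X.presheaf ⟶ F}

variable (φ) in
/-- The morphism of stalks induced by a morphism of presheaves of rings. -/
def stalkHom (x : X) : X.presheaf.stalk x →+* F.stalk x :=
  ((TopCat.Presheaf.stalkFunctor CommRingCat x).map φ).hom

theorem stalkHom_comp_germ (U : X.Opens) (x : X) (hx : x ∈ U) :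
    (stalkHom φ x).comp (X.presheaf.germ U x hx).hom =
      (F.germ U x hx).hom.comp (φ.app (op U)).hom :=
  congr(($(TopCat.Presheaf.stalkFunctor_map_germ U x hx φ)).hom)

theorem isIntegralElem_germ {U : X.Opens} {x : X} (hx : x ∈ U) {f : F.obj (op U)}
    (h : (φ.app (op U)).hom.IsIntegralElem f) :
    (stalkHom φ x).IsIntegralElem
      ((F.germ U x hx).hom f) := by
  have := h.map (F.germ U x hx).hom
  rw [← stalkHom_comp_germ] at this
  exact this.of_comp

theorem isIntegralElem_map {U V : X.Opens} (i : op U ⟶ op V) {f : F.obj (op U)}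
    (h : (φ.app (op U)).hom.IsIntegralElem f) :
    (φ.app (op V)).hom.IsIntegralElem ((F.map i).hom f) := by
  have := h.map (F.map i).hom
  rw [← CommRingCat.hom_comp, ← φ.naturality, CommRingCat.hom_comp] at this
  exact this.of_comp

theorem exists_subset_range_germ (U : X.Opens) {x : X} (hx : x ∈ U)
    (s : Finset (X.presheaf.stalk x)) :
    ∃ (V : X.Opens) (_ : V ≤ U) (hV : x ∈ V), ∀ a ∈ s, a ∈ (X.presheaf.germ V x hV).hom.range := by
  classical
  induction s using Finset.induction_on with
  | empty => exact ⟨U, le_rfl, hx, by simp⟩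
  | insert b s _ ih =>
    obtain ⟨V, hVU, hV, h⟩ := ih
    obtain ⟨W, hW, t, rfl⟩ := X.presheaf.exists_germ_eq b
    refine ⟨V ⊓ W, inf_le_left.trans hVU, ⟨hV, hW⟩, fun a ha ↦ ?_⟩
    obtain rfl | ha := Finset.mem_insert.mp ha
    · exact ⟨(X.presheaf.map (homOfLE (inf_le_right : V ⊓ W ≤ W)).op).hom t,
        X.presheaf.germ_res_apply (homOfLE inf_le_right) x ⟨hV, hW⟩ t⟩
    · obtain ⟨t, rfl⟩ := h a ha
      exact ⟨(X.presheaf.map (homOfLE (inf_le_left : V ⊓ W ≤ V)).op).hom t,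
        X.presheaf.germ_res_apply (homOfLE inf_le_left) x ⟨hV, hW⟩ t⟩

/-- A monic equation in the stalk has finitely many coefficients, so it lifts to a neighbourhood; it
then holds after further shrinking. -/
theorem exists_isIntegralElem_map {U : X.Opens} {x : X} (hx : x ∈ U) {f : F.obj (op U)}
    (h : (stalkHom φ x).IsIntegralElem
      ((F.germ U x hx).hom f)) :
    ∃ (V : X.Opens) (hV : V ≤ U), x ∈ V ∧
      (φ.app (op V)).hom.IsIntegralElem ((F.map (homOfLE hV).op).hom f) := by
  classical
  obtain ⟨P, hP, hPf⟩ := h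
  obtain ⟨V, hVU, hV, hc⟩ := exists_subset_range_germ U hx P.coeffs
  have hlift : P ∈ Polynomial.lifts (X.presheaf.germ V x hV).hom := by
    refine (Polynomial.lifts_iff_coeff_lifts _).mpr fun n ↦ ?_
    by_cases hn : P.coeff n = 0
    · exact ⟨0, by rw [map_zero, hn]⟩
    · exact hc _ (Polynomial.coeff_mem_coeffs hn)
  obtain ⟨Q, rfl, -, hQ⟩ := Polynomial.lifts_and_natDegree_eq_and_monic hlift hP
  have hz : (F.germ V x hV).hom
      (Q.eval₂ (φ.app (op V)).hom ((F.map (homOfLE hVU).op).hom f)) = 0 := by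
    rw [Polynomial.hom_eval₂, ← stalkHom_comp_germ,
      ← Polynomial.eval₂_map]
    have : (F.germ V x hV).hom ((F.map (homOfLE hVU).op).hom f) = (F.germ U x hx).hom f :=
      F.germ_res_apply (homOfLE hVU) x hV f
    rw [this, hPf]
  obtain ⟨W, hW, iV, iV', hWV⟩ := F.germ_eq x hV hV _ 0 (hz.trans (map_zero _).symm)
  refine ⟨W, iV.le.trans hVU, hW, Q.map (X.presheaf.map iV.op).hom, hQ.map _, ?_⟩
  rw [Polynomial.eval₂_map, ← CommRingCat.hom_comp, φ.naturality, CommRingCat.hom_comp]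
  have e : (F.map (homOfLE (iV.le.trans hVU)).op).hom f =
      (F.map iV.op).hom ((F.map (homOfLE hVU).op).hom f) := by
    rw [← CommRingCat.comp_apply, ← F.map_comp]
    rfl
  rw [e, ← Polynomial.hom_eval₂]
  exact hWV.trans (map_zero _)

theorem mem_integralClosurePresheaf_of_isIntegralElem {U : X.Opens} {f : F.obj (op U)}
    (h : (φ.app (op U)).hom.IsIntegralElem f) : f ∈ (integralClosurePresheaf φ).obj (op U) :=
  fun _ hx ↦ isIntegralElem_germ hx h

theorem mem_subalgebraOfStalks_of_locally {R : ∀ x : X, Subring (F.stalk x)}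
    {hR : ∀ x a, (TopCat.Presheaf.stalkFunctor CommRingCat x).map φ a ∈ R x}
    {U : X.Opens} (f : F.obj (op U)) (h : ∀ x ∈ U, ∃ (V : X.Opens) (hV : V ≤ U),
    x ∈ V ∧ (F.map (homOfLE hV).op).hom f ∈ (subalgebraOfStalks φ R hR).obj (op V)) :
    f ∈ (subalgebraOfStalks φ R hR).obj (op U) := by
  intro x hx
  obtain ⟨V, hV, hxV, hf⟩ := h x hx
  have := hf x hxV
  erw [F.germ_res_apply (homOfLE hV) x hxV f] at this
  exact this

end Germs

/-! ### The integral closure is quasi-coherent, and its subalgebras are finite. -/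

section IntegralClosure

/-- `T` embeds in the noetherian module `integralClosure A D`. The auxiliary `D` provides finite
type over `A`, which the ring of sections of `π_* 𝒪_Y` may lack. -/
theorem finite_of_injective_of_isIntegralElem {k A T D : Type*} [Field k] [CharZero k]
    [CommRing A] [IsDomain A] [CommRing T] [CommRing D] [IsDomain D] {a : k →+* A}
    (ha : a.FiniteType) (g : A →+* T) (j : T →+* D) (hj : Function.Injective j)
    (hinj : Function.Injective (j.comp g)) (hft : (j.comp g).FiniteType)
    (hint : ∀ t, (j.comp g).IsIntegralElem (j t)) : g.Finite := by
  algebraize [a, g, j, j.comp g]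
  have : FaithfulSMul A D := (faithfulSMul_iff_algebraMap_injective A D).mpr hinj
  have := isNoetherian_integralClosure k A D
  exact Module.Finite.of_injective
    ((IsScalarTower.toAlgHom A T D).codRestrict (integralClosure A D) hint).toLinearMap
    fun x y h ↦ hj congr(($h).1)

variable {X Y : Scheme.{0}} {π : Y ⟶ X}

theorem map_preimage_injective [IsIntegral Y] (π : Y ⟶ X) [IsDominant π] {U V : X.Opens}
    (i : V ⟶ U) (hV : (V : Set X).Nonempty) :
    Function.Injective (Y.presheaf.map ((Opens.map π.base).map i).op).hom := by
  obtain ⟨y, hy⟩ := π.denseRange.exists_mem_open V.isOpen hV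
  have : Nonempty (π ⁻¹ᵁ V) := ⟨⟨y, hy⟩⟩
  exact map_injective_of_isIntegral Y ((Opens.map π.base).map i)

theorem exists_map_eq_pow_mul_of_eq_basicOpen [QuasiSeparatedSpace Y] {U W : Y.Opens}
    (hU : IsCompact (U : Set Y)) (r : Γ(Y, U)) (hW : W = Y.basicOpen r) (hWU : W ≤ U)
    (f : Γ(Y, W)) : ∃ (n : ℕ) (g : Γ(Y, U)), (Y.presheaf.map (homOfLE hWU).op).hom g =
      (Y.presheaf.map (homOfLE hWU).op).hom (r ^ n) * f := by
  subst hW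
  obtain ⟨n, g, h⟩ := exists_eq_pow_mul_of_isCompact_of_isQuasiSeparated Y U hU
    (.of_quasiSeparatedSpace _) r f
  exact ⟨n, g, by rw [map_pow]; exact h⟩

theorem exists_map_eq_pow_mul [QuasiSeparatedSpace Y] [QuasiCompact π] {U : X.Opens}
    (hU : IsAffineOpen U) (r : Γ(X, U)) (f : Γ(Y, π ⁻¹ᵁ X.basicOpen r)) :
    ∃ (n : ℕ) (g : Γ(Y, π ⁻¹ᵁ U)),
      (Y.presheaf.map (homOfLE (π.preimage_mono (X.basicOpen_le r))).op).hom g =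
        (π.app (X.basicOpen r)).hom
          ((X.presheaf.map (homOfLE (X.basicOpen_le r)).op).hom (r ^ n)) * f := by
  obtain ⟨n, g, h⟩ := exists_map_eq_pow_mul_of_eq_basicOpen (π.isCompact_preimage hU.isCompact)
    ((π.app U).hom r) (Scheme.preimage_basicOpen π r) (π.preimage_mono (X.basicOpen_le r)) f
  refine ⟨n, g, h.trans ?_⟩
  rw [← map_pow]
  exact congr($((π.naturality (homOfLE (X.basicOpen_le r)).op).symm) (r ^ n) * f)

/-- Clearing denominators in the equation over the localization `Γ(X, D(r))` makes a multiple `r ^ n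
* f` integral over `Γ(X, U)` after restriction. The equation lifts because restriction is injective
on the integral scheme `Y` when `D(r)` is nonempty. -/
theorem exists_isIntegralElem_pow_mul [IsIntegral Y] [IsDominant π] {U : X.Opens}
    (hU : IsAffineOpen U) (r : Γ(X, U)) (hr : (X.basicOpen r : Set X).Nonempty)
    (f : Γ(Y, π ⁻¹ᵁ U)) (hf : (π.app (X.basicOpen r)).hom.IsIntegralElem
      ((Y.presheaf.map (homOfLE (π.preimage_mono (X.basicOpen_le r))).op).hom f)) :
    ∃ n : ℕ, (π.app U).hom.IsIntegralElem ((π.app U).hom (r ^ n) * f) := by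
  let i : X.basicOpen r ⟶ U := homOfLE (X.basicOpen_le r)
  have hinj := map_preimage_injective π i hr
  let : Algebra Γ(X, X.basicOpen r) Γ(Y, π ⁻¹ᵁ X.basicOpen r) :=
    (π.app (X.basicOpen r)).hom.toAlgebra
  let : Algebra Γ(X, U) Γ(Y, π ⁻¹ᵁ X.basicOpen r) :=
    ((π.app (X.basicOpen r)).hom.comp (X.presheaf.map i.op).hom).toAlgebra
  have : IsScalarTower Γ(X, U) Γ(X, X.basicOpen r) Γ(Y, π ⁻¹ᵁ X.basicOpen r) :=
    .of_algebraMap_eq' rfl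
  have := hU.isLocalization_basicOpen r
  obtain ⟨⟨_, n, rfl⟩, hm⟩ :=
    IsIntegral.exists_multiple_integral_of_isLocalization (Rₘ := Γ(X, X.basicOpen r))
      (.powers r) _ hf
  refine ⟨n, RingHom.IsIntegralElem.of_map (g := (Y.presheaf.map
    ((Opens.map π.base).map i).op).hom) hinj ?_⟩
  have hnat : (Y.presheaf.map ((Opens.map π.base).map i).op).hom.comp (π.app U).hom =
    (π.app (X.basicOpen r)).hom.comp (X.presheaf.map i.op).hom :=
    congr(($(π.naturality i.op)).hom).symm
  rw [hnat, map_mul]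
  erw [congr($hnat (r ^ n))]
  exact hm

/-- Over an affine open subset, the sections of the integral closure are the integral sections. -/
theorem isIntegralElem_of_mem_integralClosurePresheaf [IsIntegral Y] [IsDominant π] {U : X.Opens}
    (hU : IsAffineOpen U) {f : Γ(Y, π ⁻¹ᵁ U)}
    (hf : f ∈ (integralClosurePresheaf π.c).obj (op U)) : (π.app U).hom.IsIntegralElem f := by
  let : Algebra Γ(X, U) Γ(Y, π ⁻¹ᵁ U) := (π.app U).hom.toAlgebra
  -- The ideal of those `a` for which `a * f` is integral. Local integrality shows that the `D(r)`
  -- with a power of `r` in `I` cover `U`, so `1 ∈ I`.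
  let I : Ideal Γ(X, U) := (integralClosure Γ(X, U) Γ(Y, π ⁻¹ᵁ U)).toSubmodule.comap
    (LinearMap.toSpanSingleton Γ(X, U) Γ(Y, π ⁻¹ᵁ U) f)
  have hI (a : Γ(X, U)) : a ∈ I ↔ (π.app U).hom.IsIntegralElem ((π.app U).hom a * f) := Iff.rfl
  have hspan : I.radical = ⊤ := by
    rw [← Ideal.span_eq I.radical, ← hU.iSup_basicOpen_eq_self_iff]
    refine le_antisymm (iSup_le fun r ↦ X.basicOpen_le _) fun x hx ↦ ?_
    obtain ⟨V, hVU, hxV, hV⟩ := exists_isIntegralElem_map (φ := π.c) hx (hf x hx)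
    obtain ⟨r, hrV, hxr⟩ := hU.exists_basicOpen_le (V := V) ⟨x, hxV⟩ hx
    obtain ⟨n, hn⟩ := exists_isIntegralElem_pow_mul hU r ⟨x, hxr⟩ f (by
      have := isIntegralElem_map (φ := π.c) (homOfLE hrV).op hV
      erw [← CommRingCat.comp_apply, ← Functor.map_comp] at this
      exact this)
    exact Opens.mem_iSup.mpr ⟨⟨r, n, (hI _).mpr hn⟩, hxr⟩
  have := (hI 1).mp ((Ideal.eq_top_iff_one I).mp (Ideal.radical_eq_top.mp hspan))
  rwa [map_one, one_mul] at this

theorem subsingleton_of_eq_bot {W : Y.Opens} (hW : W = ⊥) : Subsingleton Γ(Y, W) :=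
  CommRingCat.subsingleton_of_isTerminal (Y.sheaf.isTerminalOfEqEmpty hW)

theorem isQuasicoherentSubsheaf_integralClosurePresheaf [IsIntegral X] [IsIntegral Y]
    [IsDominant π] [QuasiCompact π] [QuasiSeparatedSpace Y] :
    (integralClosurePresheaf π.c).IsQuasicoherentSubsheaf where
  mem_of_locally := mem_subalgebraOfStalks_of_locally
  exists_mem {U} hU r f hf := by
    obtain ⟨n, g, hg⟩ := exists_map_eq_pow_mul hU r f
    obtain hr | hr := (X.basicOpen r : Set X).eq_empty_or_nonempty
    · have := subsingleton_of_eq_bot (W := π ⁻¹ᵁ X.basicOpen r)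
        (by rw [show X.basicOpen r = ⊥ from Opens.ext hr]; rfl)
      exact ⟨0, 0, zero_mem _, Subsingleton.elim (α := Γ(Y, π ⁻¹ᵁ X.basicOpen r)) _ _⟩
    have hf' := isIntegralElem_of_mem_integralClosurePresheaf (hU.basicOpen r) hf
    -- The first power `r ^ n` extends `f` to a section `g`; a second power `r ^ m` makes this
    -- extension integral.
    obtain ⟨m, hm⟩ := exists_isIntegralElem_pow_mul hU r hr g (by
      rw [hg]
      exact (RingHom.isIntegralElem_map _).mul _ hf')
    refine ⟨m + n, _, mem_integralClosurePresheaf_of_isIntegralElem (φ := π.c) hm, ?_⟩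
    rw [map_mul, pow_add, map_mul, map_mul, mul_assoc]
    exact congr_arg₂ (· * ·)
      congr($((π.naturality (homOfLE (X.basicOpen_le r)).op).symm) (r ^ m)) hg

/-- Over an affine open subset, a subalgebra of the integral closure is finite. -/
theorem finite_structureMap_app {k : CommRingCat.{0}} (hk : IsField k) [CharZero k]
    [IsIntegral X] [IsIntegral Y] [IsDominant π] [QuasiCompact π] [LocallyOfFiniteType π]
    (s : X ⟶ Spec k) [LocallyOfFiniteType s] {S : SubalgebraPresheaf π.c}
    (hS : ∀ U, S.obj U ≤ (integralClosurePresheaf π.c).obj U) {U : X.Opens} (hU : IsAffineOpen U) :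
    (S.structureMap.app (op U)).hom.Finite := by
  obtain hU0 | hU0 := (U : Set X).eq_empty_or_nonempty
  · have : Subsingleton (S.obj (op U)) :=
      have := subsingleton_of_eq_bot (W := π ⁻¹ᵁ U) (by rw [show U = ⊥ from Opens.ext hU0]; rfl)
      Subtype.val_injective.subsingleton (β := Γ(Y, π ⁻¹ᵁ U))
    exact .of_surjective _ fun x ↦ ⟨0, Subsingleton.elim (α := S.obj (op U)) _ _⟩
  let : Field k := hk.toField
  obtain ⟨x, hx⟩ := hU0
  have : Nonempty U := ⟨⟨x, hx⟩⟩
  obtain ⟨y, hy⟩ := π.denseRange.exists_mem_open U.isOpen ⟨x, hx⟩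
  -- The preimage of `U` need not be affine. A nonempty affine `V` inside it has a coordinate ring
  -- of finite type over `Γ(X, U)` that contains all sections over the preimage.
  obtain ⟨_, ⟨V, hV, rfl⟩, hyV, hVU⟩ := Y.isBasis_affineOpens.exists_subset_of_mem_open hy
    (π ⁻¹ᵁ U).isOpen
  replace hVU : V ≤ π ⁻¹ᵁ U := hVU
  have : Nonempty V := ⟨⟨y, hyV⟩⟩
  let j := (Y.presheaf.map (homOfLE hVU).op).hom
  have hj : Function.Injective j := map_injective_of_isIntegral Y (homOfLE hVU)
  have hπ : Function.Injective (π.app U).hom :=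
    have := IsSchemeTheoreticallyDominant.of_isDominant π
    π.app_injective U
  have ha : ((Scheme.ΓSpecIso k).inv ≫ s.appLE ⊤ U le_top).hom.FiniteType := by
    rw [CommRingCat.hom_comp]
    exact (s.finiteType_appLE (isAffineOpen_top _) hU _).comp (.of_surjective _
      (ConcreteCategory.bijective_of_isIso (Scheme.ΓSpecIso k).inv).2)
  refine finite_of_injective_of_isIntegralElem (k := k) ha _ (j.comp (S.obj (op U)).subtype)
    (hj.comp Subtype.val_injective) (hj.comp hπ) (π.finiteType_appLE hU hV hVU) fun t ↦ ?_
  exact (isIntegralElem_of_mem_integralClosurePresheaf hU (hS _ t.2)).map j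

end IntegralClosure

/-! ### The central gluing is quasi-coherent. -/

section CentralGluing

/-- The central radical intersects fewer maximal ideals than the Jacobson radical, so it contains
the latter. -/
theorem mem_centralRadical_of_mem_jacobson {A : Type*} [CommRing A] {a : A}
    (h : ∀ I : Ideal A, I.IsMaximal → a ∈ I) : a ∈ centralRadical A :=
  Ideal.mem_sInf.mpr fun {I} hI ↦ h I hI.1

/-- Along an integral morphism maximal ideals contract to maximal ideals, and `A` has only one. -/
theorem map_mem_of_isMaximal_of_mem_maximalIdeal {A B : Type*} [CommRing A] [IsLocalRing A]
    [CommRing B] {f : A →+* B} (hf : f.IsIntegral) {a : A} (ha : a ∈ IsLocalRing.maximalIdeal A)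
    (I : Ideal B) [I.IsMaximal] : f a ∈ I := by
  have := Ideal.isMaximal_comap_of_isIntegral_of_isMaximal' f hf I
  rw [← IsLocalRing.eq_maximalIdeal this] at ha
  exact ha

variable {X : Scheme.{0}} {F : TopCat.Presheaf CommRingCat.{0} X} {φ : X.presheaf ⟶ F}

theorem isIntegral_stalkHom (h : ∀ U, IsAffineOpen U → (φ.app (op U)).hom.IsIntegral) (x : X) :
    (stalkHom φ x).IsIntegral := by
  intro t
  obtain ⟨V, hV, b, rfl⟩ := F.exists_germ_eq t
  obtain ⟨_, ⟨W, hW, rfl⟩, hxW, hWV⟩ := X.isBasis_affineOpens.exists_subset_of_mem_open hV V.isOpen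
  have := isIntegralElem_germ hxW (h W hW ((F.map (homOfLE (show W ≤ V from hWV)).op).hom b))
  erw [F.germ_res_apply] at this
  exact this

theorem mem_centralGluing_iff {U : X.Opens} {f : F.obj (op U)} :
    f ∈ (centralGluing φ).obj (op U) ↔ ∀ (x : X) (hx : x ∈ U), (F.germ U x hx).hom f ∈
      rangeAddIdeal (stalkHom φ x) (centralRadical (F.stalk x)) := Iff.rfl

/-- If the restriction of `g` to the basic open subset `D(r)` is in the central gluing, then so is
`r * g`: at a point outside of `D(r)`, the germ of `r` lies in the Jacobson radical of the stalk. -/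
theorem mul_mem_centralGluing (h : ∀ U, IsAffineOpen U → (φ.app (op U)).hom.IsIntegral)
    {U : X.Opens} (r : Γ(X, U)) (g : F.obj (op U))
    (hg : (F.map (homOfLE (X.basicOpen_le r)).op).hom g ∈
      (centralGluing φ).obj (op (X.basicOpen r))) :
    (φ.app (op U)).hom r * g ∈ (centralGluing φ).obj (op U) := by
  rw [mem_centralGluing_iff] at hg ⊢
  intro x hx
  have hφ : (F.germ U x hx).hom ((φ.app (op U)).hom r) =
      stalkHom φ x ((X.presheaf.germ U x hx).hom r) := congr($(stalkHom_comp_germ U x hx) r).symm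
  rw [map_mul, hφ]
  by_cases hxr : x ∈ X.basicOpen r
  · have := hg x hxr
    erw [F.germ_res_apply] at this
    exact mul_mem ⟨_, 0, zero_mem _, add_zero _⟩ this
  · rw [X.mem_basicOpen r x hx] at hxr
    refine ⟨0, _, ?_, (congrArg (· + _) (map_zero _)).trans (zero_add _)⟩
    exact Ideal.mul_mem_right _ _ (mem_centralRadical_of_mem_jacobson fun I _ ↦
      map_mem_of_isMaximal_of_mem_maximalIdeal (isIntegral_stalkHom h x)
        ((IsLocalRing.mem_maximalIdeal _).mpr hxr) I)

theorem SubalgebraPresheaf.isQuasicoherentSubsheaf_trans_centralGluing {S : SubalgebraPresheaf φ}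
    (hS : S.IsQuasicoherentSubsheaf)
    (hint : ∀ U, IsAffineOpen U → (S.structureMap.app (op U)).hom.IsIntegral) :
    (S.trans (centralGluing S.structureMap)).IsQuasicoherentSubsheaf where
  mem_of_locally {U} f h := by
    have hf : f ∈ S.obj (op U) := hS.mem_of_locally f fun x hx ↦ by
      obtain ⟨V, hV, hxV, g, -, hg⟩ := h x hx
      exact ⟨V, hV, hxV, hg ▸ g.2⟩
    refine ⟨⟨f, hf⟩, mem_subalgebraOfStalks_of_locally _ fun x hx ↦ ?_, rfl⟩
    obtain ⟨V, hV, hxV, g, hg, hgf⟩ := h x hx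
    refine ⟨V, hV, hxV, ?_⟩
    rwa [show (S.presheaf.map (homOfLE hV).op).hom ⟨f, hf⟩ = g from Subtype.ext hgf.symm]
  exists_mem {U} hU r f hf := by
    obtain ⟨f, hf, rfl⟩ := hf
    obtain ⟨n, g, hg, hgf⟩ := hS.exists_mem hU r f.1 f.2
    let g' : S.presheaf.obj (op U) := ⟨g, hg⟩
    let f' : S.presheaf.obj (op (X.basicOpen r)) := f
    have hgf' : (S.presheaf.map (homOfLE (X.basicOpen_le r)).op).hom g' =
      (S.structureMap.app (op (X.basicOpen r))).hom
        ((X.presheaf.map (homOfLE (X.basicOpen_le r)).op).hom (r ^ n)) * f' := Subtype.ext hgf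
    -- The power `n` extends the section within `S`; the extra factor `r` forces the gluing
    -- condition outside `D(r)`.
    refine ⟨1 + n, _, ⟨_, mul_mem_centralGluing hint r g' ?_, rfl⟩, ?_⟩
    · rw [hgf']
      exact mul_mem ((centralGluing S.structureMap).app_mem _ _) hf
    · change (F.map _).hom ((φ.app (op U)).hom r * g) = _
      rw [map_mul, hgf, pow_add, map_mul, map_mul, pow_one, mul_assoc]
      exact congrArg (· * _) congr($((φ.naturality (homOfLE (X.basicOpen_le r)).op).symm) r)

end CentralGluing

/-! ### The birational condition. -/

section Birational

variable {X Y : Scheme.{0}} [IsIntegral Y] {π : Y ⟶ X}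

theorem birationalIntegralClosure_obj_le (U : (Opens X)ᵒᵖ) :
    (birationalIntegralClosure π).obj U ≤ (integralClosurePresheaf π.c).obj U :=
  fun _ h ↦ h.1

/-- The extra condition is read at the generic point of `Y` alone. There an extension `g` of `r ^ n
* f` has the same germ as this product, and both factors have germs coming from `K(X)`. -/
theorem isQuasicoherentSubsheaf_birationalIntegralClosure
    (h : (integralClosurePresheaf π.c).IsQuasicoherentSubsheaf) :
    (birationalIntegralClosure π).IsQuasicoherentSubsheaf where
  mem_of_locally {U} f hf := by
    refine ⟨h.mem_of_locally f fun x hx ↦ ?_, fun hη ↦ ?_⟩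
    · obtain ⟨V, hV, hxV, hfV⟩ := hf x hx
      exact ⟨V, hV, hxV, hfV.1⟩
    · obtain ⟨V, hV, hxV, hfV⟩ := hf _ hη
      have := hfV.2 hxV
      erw [Y.presheaf.germ_res_apply ((Opens.map π.base).map (homOfLE hV)) _ hxV f] at this
      exact this
  exists_mem {U} hU r f hf := by
    by_cases hη : genericPoint Y ∈ π ⁻¹ᵁ X.basicOpen r
    · obtain ⟨n, g, hg, hgf⟩ := h.exists_mem hU r f hf.1
      refine ⟨n, g, ⟨hg, fun hη' ↦ ?_⟩, hgf⟩
      have := mul_mem (((birationalIntegralClosure π).app_mem _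
        ((X.presheaf.map (homOfLE (X.basicOpen_le r)).op).hom (r ^ n))).2 hη) (hf.2 hη)
      rw [← map_mul] at this
      erw [← hgf, Y.presheaf.germ_res_apply ((Opens.map π.base).map
        (homOfLE (X.basicOpen_le r))) _ hη g] at this
      exact this
    · have := subsingleton_of_eq_bot (W := π ⁻¹ᵁ X.basicOpen r) (by
        by_contra hne
        obtain ⟨y, hy⟩ := (Opens.ne_bot_iff_nonempty _).mp hne
        exact hη ((genericPoint_specializes y).mem_open (π ⁻¹ᵁ X.basicOpen r).isOpen hy))
      exact ⟨0, 0, zero_mem _, Subsingleton.elim (α := Γ(Y, π ⁻¹ᵁ X.basicOpen r)) _ _⟩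

end Birational

end CentralSeminormalization

end

theorem theorem8p14 {X Y : Scheme.{0}} [IsIntegral X] [IsIntegral Y]
    (s : X ⟶ Spec (CommRingCat.of ℝ)) [LocallyOfFiniteType s] [QuasiCompact s]
    (π : Y ⟶ X) [IsDominant π] [LocallyOfFiniteType π] [QuasiCompact π] :
    CentralSeminormalization.IsCoherentSheaf
      (CentralSeminormalization.toPresheafOfModules
        (CentralSeminormalization.centralSeminormalization s π).structureMap) ∧
    ∃ (Z : Scheme.{0}) (p : Z ⟶ X) (q : Y ⟶ Z) (h : q ≫ p = π), IsIntegral Z ∧ IsFinite p ∧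
      ∃ e : (CentralSeminormalization.centralSeminormalization s π).presheaf ≅
          (TopCat.Presheaf.pushforward CommRingCat p.base).obj Z.presheaf,
        (CentralSeminormalization.centralSeminormalization s π).structureMap ≫ e.hom = p.c ∧
        ∀ (U : X.Opens)
          (f : (CentralSeminormalization.centralSeminormalization s π).obj (op U)),
          (q.appLE (p ⁻¹ᵁ U) (π ⁻¹ᵁ U) (by subst h; exact le_rfl)).hom
            ((e.hom.app (op U)).hom f) = f.1 := by
  open CentralSeminormalization in
  have : IsLocallyNoetherian (Spec (CommRingCat.of ℝ)) := inferInstance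
  have := LocallyOfFiniteType.isLocallyNoetherian s
  -- `Y` is locally noetherian, hence quasi-separated, as the extension of sections from `D(r)`
  -- requires.
  have := LocallyOfFiniteType.isLocallyNoetherian π
  have hk : IsField (CommRingCat.of ℝ) := Field.toIsField ℝ
  have : CharZero (CommRingCat.of ℝ) := inferInstanceAs (CharZero ℝ)
  have hC := isQuasicoherentSubsheaf_integralClosurePresheaf (π := π)
  have hB := isQuasicoherentSubsheaf_birationalIntegralClosure hC
  have hle : ∀ U, (centralSeminormalization s π).obj U ≤ (integralClosurePresheaf π.c).obj U := by
    unfold centralSeminormalization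
    split_ifs
    · rintro U _ ⟨f, -, rfl⟩
      exact birationalIntegralClosure_obj_le U f.2
    · exact fun _ ↦ le_rfl
  have hS : (centralSeminormalization s π).IsQuasicoherentSubsheaf := by
    unfold centralSeminormalization
    split_ifs
    · refine SubalgebraPresheaf.isQuasicoherentSubsheaf_trans_centralGluing hB fun U hU ↦ ?_
      exact (finite_structureMap_app hk s birationalIntegralClosure_obj_le hU).to_isIntegral
    · exact hC
  obtain ⟨hcoh, Z, p, q, h, hZ, hp, e, he, he'⟩ :=
    exists_relSpec hS fun U hU ↦ finite_structureMap_app hk s hle hU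
  exact ⟨hcoh, Z, p, q, h, hZ, hp, e, he, fun U f ↦ congr(($(he').app (op U)).hom f)⟩
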